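/- **Setting.** Let $z_1,\dots,z_m$ be distinct points of a measurable space $\mathcal X$ with measurable singletons, $h:\mathcal X^T\to\mathbb R$, $g:\mathcal X^S\to\mathbb R$, $y_1,\dots,y_n\in\mathbb R$ data with empirical distribution function $\hat F_Y$, and $q\in\mathbb R$ a critical value (typically a quantile of the Kolmogorov–Smirnov limit). For $\mathbf p\in\mathbb R^m$ in the probability simplex, $E_{\mathbf p}$ denotes expectation when the entries of $\mathbf X=(X_1,X_2,\dots)$ are i.i.d. with $P(X_t=z_i)=p_i$. Put $\psi(\mathbf p)=E_{\mathbf p}[g(\mathbf X)]$, $F_j(\mathbf p)=E_{\mathbf p}[I(h(\mathbf X)\le y_j)]$, $l_j=\hat F_Y(y_j+)-q/\sqrt n$, $u_j=\hat F_Y(y_j-)+q/\sqrt n$, let $\Pi_j$ be the projection of $\mathbb R$ onto $[l_j,u_j]$ (that is, $\Pi_j(x)=l_j$ if $x<l_j$, $u_j$ if $x>u_j$, and $x$ otherwise), and let $W(\mathbf p)=\sum_{j=1}^n(F_j(\mathbf p)-\Pi_j(F_j(\mathbf p)))^2$. Let $0<\epsilon<1/m$ and $\mathcal P(\epsilon)=\{\mathbf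 p:\sum_ip_i=1,\ p_i\ge\epsilon\ \forall i\}$. The restricted program is: minimize $\psi(\mathbf p)$ over $\mathbf p\in\mathcal P(\epsilon)$ subject to $l_j\le F_j(\mathbf p)\le u_j$, $j=1,\dots,n$. Let $\Psi_i(\mathbf p)=\frac{d}{de}\psi((1-e)\mathbf p+e\mathbf 1_i)|_{e=0+}$ and $\phi_i(\mathbf p)=\frac{d}{de}W((1-e)\mathbf p+e\mathbf 1_i)|_{e=0+}$ be the Gateaux derivatives, where $\mathbf 1_i$ is the $i$-th unit vector. **Assumptions.** 1. The restricted program has a unique optimal solution $\mathbf p^*_\epsilon$; $\boldsymbol\Psi(\mathbf p)'(\mathbf p-\mathbf p^*_\epsilon)>0$ for every feasible $\mathbf p\ne\mathbf p^*_\epsilon$, and $\boldsymbol\phi(\mathbf p)'(\mathbf p-\mathbf p^*_\epsilon)>0$ for every infeasible $\mathbf p\in\mathcal P(\epsilon)$. 2. There is $\lambda_\epsilon>0$ such that for each $\lambda\in(0,\lambda_\epsilon]$ the program $\min_{\mathbf p\in\mathcal P(\epsilon)}\lambda\psi(\mathbf p)+W(\mathbf p)$ has a unique optimal solution $\mathbf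 p^*_\epsilon(\lambda)$, with $(\lambda\boldsymbol\Psi(\mathbf p)+\boldsymbol\phi(\mathbf p))'(\mathbf p-\mathbf p^*_\epsilon(\lambda))\ge0$ for all $\mathbf p\in\mathcal P(\epsilon)$; and $\lambda\mapsto\mathbf p^*_\epsilon(\lambda)$ has finite total variation on $(0,\lambda_\epsilon]$. 3. $\|\mathbf p^*_\epsilon(\lambda)-\mathbf p^*_\epsilon\|=O(\lambda)$ as $\lambda\downarrow0$. **Algorithm.** Start from $\mathbf p^1\in\mathcal P(\epsilon)$ and $\mathbf s^1\in\prod_j[l_j,u_j]$, and fix sample sizes $M_1,M_2,M_3\ge1$. At iteration $k=1,2,\dots$, conditionally on the past, simulate independent input sequences $\mathbf X^{(r)}$ ($r\le M_1$), $\tilde{\mathbf X}^{(r)}$ ($r\le M_2$) of length $T$ and $\tilde{\tilde{\mathbf X}}^{(r)}$ ($r\le M_3$) of length $S$, with all entries i.i.d. under $\mathbf p^k$. With $S_i(\mathbf x;\mathbf p)=\sum_{t=1}^L I(x_t=z_i)/p_i-L$ for a sequence $\mathbf x$ of length $L$, put $$\hat\phi^k_{\mathbf p,i}=2\sum_{j=1}^n\frac1{M_1}\sum_{r=1}^{M_1}\big(I(h(\mathbf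 X^{(r)})\le y_j)-s^k_j\big)\cdot\frac1{M_2}\sum_{r=1}^{M_2}I(h(\tilde{\mathbf X}^{(r)})\le y_j)S_i(\tilde{\mathbf X}^{(r)};\mathbf p^k),$$ $$\hat\Psi^k_i=\frac1{M_3}\sum_{r=1}^{M_3}g(\tilde{\tilde{\mathbf X}}^{(r)})S_i(\tilde{\tilde{\mathbf X}}^{(r)};\mathbf p^k),$$ $$\hat\phi^k_{\mathbf s,j}=-\frac2{M_1+M_2}\Big(\sum_{r=1}^{M_1}\big(I(h(\mathbf X^{(r)})\le y_j)-s_j^k\big)+\sum_{r=1}^{M_2}\big(I(h(\tilde{\mathbf X}^{(r)})\le y_j)-s_j^k\big)\Big).$$ Set $s^{k+1}_j=\Pi_j(s^k_j-\beta^k\hat\phi^k_{\mathbf s,j})$. Set $\xi_i=\gamma^k(\lambda^k\hat\Psi^k_i+\hat\phi^k_{\mathbf p,i})$ and let $\mathbf p^{k+1}$ be the output of the following sort-and-search procedure. Put $w_i=p^k_ie^{-\xi_i}$, sort them as $w_{(1)}\le\dots\le w_{(m)}$, set $w_{(0)}=0$, find $i^*\in\{0,\dots,m-1\}$ with $$\frac{w_{(i^*)}}{i^*w_{(i^*)}+\sum_{i>i^*}w_{(i)}}\le\epsilon<\frac{w_{(i^*+1)}}{(i^*+1)w_{(i^*+1)}+\sum_{i>i^*+1}w_{(i)}},$$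 let $\eta^*=\epsilon\sum_{i>i^*}w_{(i)}/(1-\epsilon i^*)$, and output $p^{k+1}_i=\max\{\eta^*,w_i\}/\sum_{l=1}^m\max\{\eta^*,w_l\}$. **Theorem.** Under Assumptions 1–3, let $a,b,c>0$, $\frac34<\alpha_1\le1$, $2-2\alpha_1<\alpha_2<2\alpha_1-1$, and for $k\ge1$ let $\gamma^k=a/k^{\alpha_1}$ and $\beta^k=b/k^{\alpha_2}$. If $\alpha_1<1$, let $\lambda^k=c/k^{\alpha_3}$ with $0<\alpha_3\le1-\alpha_1$; if $\alpha_1=1$, let $\lambda^k=c/\log k$ for $k\ge2$ and let $\lambda^1>0$ be arbitrary. Then the iterates $\mathbf p^k$ converge to $\mathbf p^*_\epsilon$ almost surely. -/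

import Mathlib

open MeasureTheory ProbabilityTheory Filter Topology

noncomputable section

namespace MDSA

/-- `E_p[f(X)]`, where `X = (X_1, …, X_L)` is i.i.d. and each `X_t` equals the support point `z i`
with probability `p i`. -/
def inputExp {𝒳 : Type*} {m : ℕ} (z : Fin m → 𝒳) (L : ℕ) (p : Fin m → ℝ)
    (f : (Fin L → 𝒳) → ℝ) : ℝ :=
  ∑ ι : Fin L → Fin m, (∏ t, p (ι t)) * f (fun t => z (ι t))

/-- The empirical distribution function of the data `y_1, …, y_n`. -/
def empiricalCDF {n : ℕ} (y : Fin n → ℝ) (t : ℝ) : ℝ :=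
  ((Finset.univ.filter fun l => y l ≤ t).card : ℝ) / n

/-- The restricted probability simplex `P(ε)`. -/
def restrictedSimplex (m : ℕ) (ε : ℝ) : Set (Fin m → ℝ) :=
  {p | p ∈ stdSimplex ℝ (Fin m) ∧ ∀ i, ε ≤ p i}

open Classical in
/-- The score `S_i(x; p) = ∑_t I(x_t = z_i) / p_i - L` of an input sequence of length `L`. -/
def score {𝒳 : Type*} {m : ℕ} (z : Fin m → 𝒳) {L : ℕ} (p : Fin m → ℝ) (i : Fin m)
    (x : Fin L → 𝒳) : ℝ :=
  (∑ t, (if x t = z i then (1 : ℝ) else 0) / p i) - L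

/-- The Gateaux derivative
`(d/de) F((1 - e) p + e 1_i)` at `e = 0+`, as a vector indexed by `i`. -/
def gateaux {m : ℕ} (F : (Fin m → ℝ) → ℝ) (p : Fin m → ℝ) (i : Fin m) : ℝ :=
  derivWithin (fun e : ℝ => F ((1 - e) • p + e • (Pi.single i 1 : Fin m → ℝ))) (Set.Ici 0) 0

/-- `x` is the unique optimal solution of the program `min F` over `A`. -/
def IsUniqueMin {E : Type*} (F : E → ℝ) (A : Set E) (x : E) : Prop :=
  x ∈ A ∧ IsMinOn F A x ∧ ∀ x' ∈ A, IsMinOn F A x' → x' = x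

/-- The data of the discretized calibration problem: `m` distinct support points `z`, output map
`h` of `T` inputs, target `g` of `S` inputs, `n` output observations `y`, and the critical value
`q` of the Kolmogorov-Smirnov statistic. -/
structure Problem (𝒳 : Type*) (m n T S : ℕ) where
  z : Fin m → 𝒳
  z_injective : Function.Injective z
  h : (Fin T → 𝒳) → ℝ
  g : (Fin S → 𝒳) → ℝ
  y : Fin n → ℝ
  q : ℝ

namespace Problem

variable {𝒳 : Type*} {m n T S : ℕ} (C : Problem 𝒳 m n T S)

/-- Lower end of the `j`-th interval: right limit of the empirical distribution minus `q / √n`. -/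
def lo (j : Fin n) : ℝ :=
  Function.rightLim (empiricalCDF C.y) (C.y j) - C.q / Real.sqrt n

/-- Upper end of the `j`-th interval: left limit of the empirical distribution plus `q / √n`. -/
def hi (j : Fin n) : ℝ :=
  Function.leftLim (empiricalCDF C.y) (C.y j) + C.q / Real.sqrt n

/-- The projection `Π_j` onto `[lo j, hi j]`. -/
def proj (j : Fin n) (x : ℝ) : ℝ :=
  if x < C.lo j then C.lo j else if C.hi j < x then C.hi j else x

/-- The indicator `I(h(x) ≤ y_j)`. -/
def ind (j : Fin n) (x : Fin T → 𝒳) : ℝ :=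
  if C.h x ≤ C.y j then 1 else 0

/-- `ψ(p) = E_p[g(X)]`. -/
def psi (p : Fin m → ℝ) : ℝ := inputExp C.z S p C.g

/-- `E_p[I(h(X) ≤ y_j)]`. -/
def outProb (p : Fin m → ℝ) (j : Fin n) : ℝ := inputExp C.z T p (C.ind j)

/-- The quadratic penalty `∑_j (E_p[I(h(X) ≤ y_j)] - Π_j(E_p[I(h(X) ≤ y_j)]))²`. -/
def penalty (p : Fin m → ℝ) : ℝ :=
  ∑ j, (C.outProb p j - C.proj j (C.outProb p j)) ^ 2

/-- The feasible set of the restricted program. -/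
def feasible (ε : ℝ) : Set (Fin m → ℝ) :=
  {p | p ∈ restrictedSimplex m ε ∧ ∀ j, C.lo j ≤ C.outProb p j ∧ C.outProb p j ≤ C.hi j}

/-- `pStar` is the unique optimal solution of the restricted program, and satisfies the strict
generalized convexity criterion. -/
structure ConvexityCriterion (ε : ℝ) (pStar : Fin m → ℝ) : Prop where
  optimal : IsUniqueMin C.psi (C.feasible ε) pStar
  feasible_pos : ∀ p ∈ C.feasible ε, p ≠ pStar →
    0 < ∑ i, gateaux C.psi p i * (p i - pStar i)
  infeasible_pos : ∀ p ∈ restrictedSimplex m ε, p ∉ C.feasible ε →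
    0 < ∑ i, gateaux C.penalty p i * (p i - pStar i)

/-- For some `l₀ > 0`, on `(0, l₀]` the penalized restricted program with penalty coefficient `l`
has the unique optimal solution `path l`, which satisfies the weak generalized convexity criterion,
and `path` has finite total variation there. -/
def PenalizedPath (ε : ℝ) (path : ℝ → Fin m → ℝ) : Prop :=
  ∃ l₀ : ℝ, 0 < l₀ ∧
    (∀ l ∈ Set.Ioc 0 l₀,
      IsUniqueMin (fun p => l * C.psi p + C.penalty p) (restrictedSimplex m ε) (path l) ∧
      ∀ p ∈ restrictedSimplex m ε,
        0 ≤ ∑ i, (l * gateaux C.psi p i + gateaux C.penalty p i) * (p i - path l i)) ∧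
    BoundedVariationOn path (Set.Ioc 0 l₀)

/-- Estimator of the gradient of the penalty with respect to `p`, from the batches `X`, `X'`. -/
def phiPHat {M₁ M₂ : ℕ} (p : Fin m → ℝ) (s : Fin n → ℝ) (X : Fin M₁ → Fin T → 𝒳)
    (X' : Fin M₂ → Fin T → 𝒳) (i : Fin m) : ℝ :=
  2 * ∑ j, ((1 / (M₁ : ℝ)) * ∑ r, (C.ind j (X r) - s j)) *
    ((1 / (M₂ : ℝ)) * ∑ r, C.ind j (X' r) * score C.z p i (X' r))

/-- Estimator of the gradient of `ψ`, from the batch `X''`. -/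
def psiHat {M₃ : ℕ} (p : Fin m → ℝ) (X'' : Fin M₃ → Fin S → 𝒳) (i : Fin m) : ℝ :=
  (1 / (M₃ : ℝ)) * ∑ r, C.g (X'' r) * score C.z p i (X'' r)

/-- Estimator of the gradient of the penalty with respect to `s`, from the batches `X`, `X'`. -/
def phiSHat {M₁ M₂ : ℕ} (s : Fin n → ℝ) (X : Fin M₁ → Fin T → 𝒳)
    (X' : Fin M₂ → Fin T → 𝒳) (j : Fin n) : ℝ :=
  -(2 / ((M₁ : ℝ) + M₂)) * (∑ r, (C.ind j (X r) - s j) + ∑ r, (C.ind j (X' r) - s j))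

end Problem

/-- The weights `w_1, …, w_m` in ascending order: `sorted w i` is the `i`-th smallest one
for `1 ≤ i ≤ m`, and `sorted w 0 = 0`. -/
def sorted {m : ℕ} (w : Fin m → ℝ) (i : ℕ) : ℝ :=
  if hi : 1 ≤ i ∧ i ≤ m then w (Tuple.sort w ⟨i - 1, by omega⟩) else 0

/-- The output `q` of the sort-and-search procedure for
`min ξ'(q - p) + ∑_i q_i log (q_i / p_i)` over `q ∈ P(ε)`. -/
def SortSearch {m : ℕ} (ε : ℝ) (p ξ q : Fin m → ℝ) : Prop :=
  let w : Fin m → ℝ := fun i => p i * Real.exp (-ξ i)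
  ∃ i : ℕ, i < m ∧
    sorted w i / (i * sorted w i + ∑ l ∈ Finset.Icc (i + 1) m, sorted w l) ≤ ε ∧
    ε < sorted w (i + 1) /
      ((i + 1) * sorted w (i + 1) + ∑ l ∈ Finset.Icc (i + 2) m, sorted w l) ∧
    let η : ℝ := ε * (∑ l ∈ Finset.Icc (i + 1) m, sorted w l) / (1 - ε * i)
    ∀ i', q i' = max η (w i') / ∑ l, max η (w l)

/-- A run of the mirror descent stochastic approximation with slack variables, on a probability
space `(Ω, μ)` with a filtration `ℱ` (`ℱ k` is the information available before the simulations of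
iteration `k`). The iterations are `k = 1, 2, …`; `p k`, `s k` are the iterates, and
`X k`, `X' k`, `X'' k` are the batches of `M₁`, `M₂`, `M₃` input sequences simulated at
iteration `k`. -/
structure IsRun {𝒳 : Type*} [MeasurableSpace 𝒳] {m n T S : ℕ} (C : Problem 𝒳 m n T S) (ε : ℝ)
    (γ β lam : ℕ → ℝ) {M₁ M₂ M₃ : ℕ}
    {Ω : Type*} {mΩ : MeasurableSpace Ω} (μ : Measure Ω) (ℱ : Filtration ℕ mΩ)
    (X : ℕ → Ω → Fin M₁ → Fin T → 𝒳) (X' : ℕ → Ω → Fin M₂ → Fin T → 𝒳)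
    (X'' : ℕ → Ω → Fin M₃ → Fin S → 𝒳)
    (p : ℕ → Ω → Fin m → ℝ) (s : ℕ → Ω → Fin n → ℝ) : Prop where
  /-- Initial solution in `P(ε)` and initial slack variables in the product of the intervals. -/
  init_p : ∀ ω, p 1 ω ∈ restrictedSimplex m ε
  init_s : ∀ ω j, C.lo j ≤ s 1 ω j ∧ s 1 ω j ≤ C.hi j
  measurable_p : ∀ k ≥ 1, Measurable[ℱ k] (p k)
  measurable_s : ∀ k ≥ 1, Measurable[ℱ k] (s k)
  measurable_X : ∀ k ≥ 1, Measurable (X k)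
  measurable_X' : ∀ k ≥ 1, Measurable (X' k)
  measurable_X'' : ∀ k ≥ 1, Measurable (X'' k)
  /-- Given the past, the `M₁ + M₂ + M₃` sequences simulated at iteration `k` are independent, and
  the entries of each are i.i.d. under the input distribution `p k`. -/
  sampling : ∀ k ≥ 1, ∀ (ι : Fin M₁ → Fin T → Fin m) (ι' : Fin M₂ → Fin T → Fin m)
    (ι'' : Fin M₃ → Fin S → Fin m),
    μ⟦{ω | (X k ω = fun r t => C.z (ι r t)) ∧ (X' k ω = fun r t => C.z (ι' r t)) ∧
        (X'' k ω = fun r t => C.z (ι'' r t))} | ℱ k⟧ =ᵐ[μ]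
      fun ω => (∏ r, ∏ t, p k ω (ι r t)) * (∏ r, ∏ t, p k ω (ι' r t)) *
        (∏ r, ∏ t, p k ω (ι'' r t))
  step_p : ∀ k ≥ 1, ∀ ω, SortSearch ε (p k ω)
    (fun i => γ k * (lam k * C.psiHat (p k ω) (X'' k ω) i +
      C.phiPHat (p k ω) (s k ω) (X k ω) (X' k ω) i)) (p (k + 1) ω)
  step_s : ∀ k ≥ 1, ∀ ω j, s (k + 1) ω j =
    C.proj j (s k ω j - β k * C.phiSHat (s k ω) (X k ω) (X' k ω) j)

end MDSA

end

/-! The proof is a Lyapunov argument with a moving target. Write `u k` for the minimizer `path (lam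
k)` of the penalized program; the Lyapunov function is the divergence `kl (u k) (p k)`. The
sort-and-search output satisfies the variational inequality of the entropic proximal step
(`SortSearch.optimality`), so one iteration lowers the divergence on average by `γ k` times the
drift `(λΨ + φ)'(p - u)`, up to three errors: `γ k ^ 2`, the displacement of the target, and `γ k`
times the error made by using the slack variable `s` in place of `Π_j(F_j(p))` in the gradient of
the penalty (`IsRun.exists_condExp_kl_le`). The drift is nonnegative by the second assumption.

All three errors are summable in mean. The squares are summable because `2 * α₁ > 1`, and the
displacements because the path has finite variation and `lam` is eventually decreasing. The slack
variables run on the faster time scale `β`: their mean square error contracts by `1 - 2β` up to a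
term of order `β² + γ²/β`. A weighted telescoping sum and the arithmetic-geometric inequality then
make `γ E|error|` summable; this is where both bounds on `α₂` are used
(`exists_summable_weighted_of_recursion`, `IsRun.summable_integral_slackError`).

The Robbins-Siegmund theorem now says that almost surely the divergence converges and `∑ γ · drift`
is finite. Since `∑ γ λ` diverges, the drift is `o(λ)` along a subsequence. At a limit point `y` of
it, `φ(y)'(y - pStar) ≤ 0`, so `y` is feasible by the first assumption. As `u - pStar = O(λ)` and
`φ` vanishes at `y`, division by `λ` gives `Ψ(y)'(y - pStar) ≤ 0`, hence `y = pStar`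
(`Problem.eq_of_tendsto_of_drift_le`). The limit of the divergence is therefore zero, and every
limit point of the iterates is `pStar`. -/

noncomputable section

namespace MDSA

section FiniteExpectation

/-! ### Expectations over finite product distributions -/

theorem sum_prod_mul_apply {K : Type*} [Fintype K] {M : ℕ} {w : K → ℝ} (hw : ∑ k, w k = 1)
    (f : K → ℝ) (r₀ : Fin M) :
    ∑ x : Fin M → K, (∏ r, w (x r)) * f (x r₀) = ∑ k, w k * f k := by
  have h := Finset.prod_univ_sum (fun _ : Fin M => (Finset.univ : Finset K))
    (fun r k => if r = r₀ then w k * f k else w k)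
  rw [Fintype.piFinset_univ] at h
  have h1 : ∀ x : Fin M → K, (∏ r, if r = r₀ then w (x r) * f (x r) else w (x r)) =
      (∏ r, w (x r)) * f (x r₀) := by
    intro x
    have : ∀ r, (if r = r₀ then w (x r) * f (x r) else w (x r)) =
        w (x r) * (if r = r₀ then f (x r) else 1) := by
      intro r; split_ifs <;> simp
    simp_rw [this, Finset.prod_mul_distrib]
    simp
  simp_rw [h1] at h
  rw [← h, Finset.prod_eq_single r₀]
  · simp
  · intro r _ hr; simp [hr, hw]
  · simp

theorem sum_prod_eq_one {K : Type*} [Fintype K] {M : ℕ} {w : K → ℝ} (hw : ∑ k, w k = 1) :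
    ∑ x : Fin M → K, ∏ r, w (x r) = 1 := by
  have h := Finset.prod_univ_sum (fun _ : Fin M => (Finset.univ : Finset K)) (fun _ k => w k)
  rw [Fintype.piFinset_univ] at h
  rw [← h]; simp [hw]

theorem sum_prod_mul_sum {K : Type*} [Fintype K] {M : ℕ} {w : K → ℝ} (hw : ∑ k, w k = 1)
    (f : K → ℝ) :
    ∑ x : Fin M → K, (∏ r, w (x r)) * ∑ r, f (x r) = M * ∑ k, w k * f k := by
  simp_rw [Finset.mul_sum]
  rw [Finset.sum_comm]
  simp_rw [sum_prod_mul_apply hw f, ← Finset.mul_sum]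
  simp

theorem sum_prod_mul_average {K : Type*} [Fintype K] {M : ℕ} (hM : 0 < M) {w : K → ℝ}
    (hw : ∑ k, w k = 1) (f : K → ℝ) :
    ∑ x : Fin M → K, (∏ r, w (x r)) * ((1 / (M : ℝ)) * ∑ r, f (x r)) = ∑ k, w k * f k := by
  have h : ∀ x : Fin M → K, (∏ r, w (x r)) * ((1 / (M : ℝ)) * ∑ r, f (x r)) =
      (1 / (M : ℝ)) * ((∏ r, w (x r)) * ∑ r, f (x r)) := fun x => by ring
  simp_rw [h, ← Finset.mul_sum, sum_prod_mul_sum hw]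
  have : (M : ℝ) ≠ 0 := by positivity
  field_simp

end FiniteExpectation

/-! ### Expectations under i.i.d. inputs and their score-function derivatives -/

section InputExpectation

variable {𝒳 : Type*} {m : ℕ} {z : Fin m → 𝒳} {L : ℕ} {p : Fin m → ℝ}

theorem inputExp_sub_const (hp : ∑ i, p i = 1) (f : (Fin L → 𝒳) → ℝ) (c : ℝ) :
    inputExp z L p (fun x => f x - c) = inputExp z L p f - c := by
  simp only [inputExp, mul_sub, Finset.sum_sub_distrib, ← Finset.sum_mul, sum_prod_eq_one hp,
    one_mul]

theorem contDiff_inputExp (z : Fin m → 𝒳) (L : ℕ) (f : (Fin L → 𝒳) → ℝ) :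
    ContDiff ℝ 1 (fun p => inputExp z L p f) := by
  unfold inputExp
  refine ContDiff.sum fun ι _ => ContDiff.mul (contDiff_prod fun t _ => ?_) contDiff_const
  exact contDiff_apply ℝ ℝ (ι t)

open Classical in
theorem score_comp (hz : Function.Injective z) (i : Fin m) (ι : Fin L → Fin m) :
    score z p i (fun t => z (ι t)) = (∑ t, (if ι t = i then (1 : ℝ) else 0) / p i) - L := by
  simp [score, hz.eq_iff]

/-- The expectation of `f` times the score is the derivative of the expectation of `f` in the
direction of the corresponding vertex of the simplex. -/
theorem hasDerivAt_inputExp (hz : Function.Injective z) (hp : ∀ i, 0 < p i)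
    (f : (Fin L → 𝒳) → ℝ) (i : Fin m) :
    HasDerivAt (fun e : ℝ => inputExp z L ((1 - e) • p + e • (Pi.single i 1 : Fin m → ℝ)) f)
      (inputExp z L p (fun x => f x * score z p i x)) 0 := by
  classical
  unfold inputExp
  refine HasDerivAt.fun_sum fun ι _ => ?_
  -- The derivative of each factor is written as the factor times its logarithmic derivative, so
  -- that the product rule returns the full product times a sum over `t`, which is the score.
  have h1 : ∀ t, HasDerivAt
      (fun e : ℝ => ((1 - e) • p + e • (Pi.single i 1 : Fin m → ℝ)) (ι t))
      (p (ι t) * ((if ι t = i then 1 else 0) / p i - 1)) 0 := by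
    intro t
    have h2 : HasDerivAt (fun e : ℝ => (1 - e) * p (ι t) + e * (if ι t = i then 1 else 0))
        ((0 - 1) * p (ι t) + 1 * (if ι t = i then 1 else 0)) 0 :=
      (((hasDerivAt_const _ _).sub (hasDerivAt_id _)).mul_const _).add
        ((hasDerivAt_id _).mul_const _)
    convert h2 using 1
    · ext e; simp [Pi.single_apply]
    · have := (hp i).ne'
      split_ifs with h
      · rw [h]; field_simp; ring
      · simp
  have h3 := (HasDerivAt.fun_finsetProd (u := Finset.univ) (fun t _ => h1 t)).mul_const
    (f fun t => z (ι t))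
  refine h3.congr_deriv ?_
  beta_reduce
  rw [score_comp hz]
  have h4 : ∀ t, (∏ j ∈ Finset.univ.erase t,
      ((1 - (0 : ℝ)) • p + (0 : ℝ) • (Pi.single i 1 : Fin m → ℝ)) (ι j)) •
        (p (ι t) * ((if ι t = i then 1 else 0) / p i - 1)) =
      (∏ j, p (ι j)) * ((if ι t = i then 1 else 0) / p i - 1) := by
    intro t
    rw [smul_eq_mul, ← mul_assoc, ← Finset.prod_erase_mul _ _ (Finset.mem_univ t)]
    simp
  simp_rw [h4, ← Finset.mul_sum, Finset.sum_sub_distrib]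
  simp; ring

theorem gateaux_inputExp (hz : Function.Injective z) (hp : ∀ i, 0 < p i)
    (f : (Fin L → 𝒳) → ℝ) (i : Fin m) :
    gateaux (fun p => inputExp z L p f) p i = inputExp z L p (fun x => f x * score z p i x) :=
  (hasDerivAt_inputExp hz hp f i).hasDerivWithinAt.derivWithin (uniqueDiffOn_Ici 0 0 (by simp))

theorem continuousOn_inputExp_score (hz : Function.Injective z) (f : (Fin L → 𝒳) → ℝ)
    (i : Fin m) :
    ContinuousOn (fun p => inputExp z L p (fun x => f x * score z p i x)) {p | p i ≠ 0} := by
  unfold inputExp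
  simp_rw [score_comp hz]
  refine continuousOn_finsetSum _ fun ι _ => ContinuousOn.mul (by fun_prop) ?_
  refine continuousOn_const.mul (ContinuousOn.sub ?_ continuousOn_const)
  exact continuousOn_finsetSum _ fun t _ =>
    ContinuousOn.div continuousOn_const (by fun_prop) fun p hp => hp

end InputExpectation

/-! ### The restricted simplex -/

section Simplex

variable {m : ℕ} {ε : ℝ}

theorem isCompact_restrictedSimplex (m : ℕ) (ε : ℝ) : IsCompact (restrictedSimplex m ε) := by
  have : restrictedSimplex m ε = stdSimplex ℝ (Fin m) ∩ ⋂ i, {p | ε ≤ p i} := by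
    ext p; simp [restrictedSimplex]
  rw [this]
  exact (isCompact_stdSimplex ℝ (Fin m)).inter_right
    (isClosed_iInter fun i => isClosed_le continuous_const (continuous_apply i))

theorem le_one_of_mem {p : Fin m → ℝ} (hp : p ∈ restrictedSimplex m ε) (i : Fin m) :
    p i ≤ 1 := by
  rw [← hp.1.2]
  exact Finset.single_le_sum (fun j _ => hp.1.1 j) (Finset.mem_univ i)

theorem pos_of_mem (hε : 0 < ε) {p : Fin m → ℝ} (hp : p ∈ restrictedSimplex m ε)
    (i : Fin m) : 0 < p i := hε.trans_le (hp.2 i)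

end Simplex

/-! ### The projection onto the intervals and the gradient of the penalty -/

namespace Problem

variable {𝒳 : Type*} {m n T S : ℕ} (C : Problem 𝒳 m n T S)

theorem proj_eq {j : Fin n} (h : C.lo j ≤ C.hi j) (x : ℝ) :
    C.proj j x = max (C.lo j) (min (C.hi j) x) := by
  unfold proj
  split_ifs with h1 h2
  · rw [max_eq_left]; exact (min_le_right _ _).trans h1.le
  · rw [min_eq_left h2.le, max_eq_right h]
  · push Not at h1 h2; rw [min_eq_right h2, max_eq_right h1]

theorem proj_mem {j : Fin n} (h : C.lo j ≤ C.hi j) (x : ℝ) :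
    C.lo j ≤ C.proj j x ∧ C.proj j x ≤ C.hi j := by
  rw [C.proj_eq h]
  exact ⟨le_max_left _ _, max_le h (min_le_left _ _)⟩

theorem abs_proj_sub_proj_le {j : Fin n} (h : C.lo j ≤ C.hi j) (x y : ℝ) :
    |C.proj j x - C.proj j y| ≤ |x - y| := by
  rw [C.proj_eq h, C.proj_eq h]
  rw [max_comm, max_comm (C.lo j), min_comm, min_comm (C.hi j)]
  exact (abs_max_sub_max_le_abs _ _ _).trans (abs_min_sub_min_le_max _ _ _ _ |>.trans (by simp))

/-- The projection of `x` is stationary for projected steps towards `x`. -/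
theorem proj_add_mul {j : Fin n} (h : C.lo j ≤ C.hi j) (x : ℝ) {t : ℝ} (ht : 0 ≤ t) :
    C.proj j (C.proj j x + t * (x - C.proj j x)) = C.proj j x := by
  unfold proj
  split_ifs <;> first | rfl | nlinarith

theorem continuous_proj {j : Fin n} (h : C.lo j ≤ C.hi j) : Continuous (C.proj j) := by
  have : C.proj j = fun x => max (C.lo j) (min (C.hi j) x) := funext (C.proj_eq h)
  rw [this]; fun_prop

/-- The projection has kinks at the endpoints, but the squared distance to an interval is
differentiable there too: its first-order Taylor remainder is at most `(y - x) ^ 2` in every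
configuration of `x`, `y` and the interval. -/
theorem hasDerivAt_sq_sub_proj {j : Fin n} (h : C.lo j ≤ C.hi j) (x : ℝ) :
    HasDerivAt (fun x => (x - C.proj j x) ^ 2) (2 * (x - C.proj j x)) x := by
  rw [hasDerivAt_iff_isLittleO]
  refine Asymptotics.IsBigO.trans_isLittleO (g := fun y => (y - x) ^ 2) ?_ ?_
  · refine Asymptotics.IsBigO.of_bound 1 (Eventually.of_forall fun y => ?_)
    rw [one_mul, Real.norm_eq_abs, Real.norm_eq_abs, abs_of_nonneg (sq_nonneg (y - x)), abs_le,
      smul_eq_mul]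
    unfold proj
    constructor <;> split_ifs <;> nlinarith
  · have := (Asymptotics.isLittleO_pow_sub_sub x (show 1 < 2 by norm_num))
    simpa using this

/-- The derivative of the `j`-th output probability towards the `i`-th vertex. -/
def outGrad (p : Fin m → ℝ) (j : Fin n) (i : Fin m) : ℝ :=
  inputExp C.z T p (fun x => C.ind j x * score C.z p i x)

theorem gateaux_psi {p : Fin m → ℝ} (hp : ∀ i, 0 < p i) (i : Fin m) :
    gateaux C.psi p i = inputExp C.z S p (fun x => C.g x * score C.z p i x) :=
  gateaux_inputExp C.z_injective hp C.g i

/-- No derivative of the projection appears. Hence replacing the projected probability by a slack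
variable changes the gradient only linearly in the slack error. -/
theorem gateaux_penalty (h : ∀ j, C.lo j ≤ C.hi j) {p : Fin m → ℝ} (hp : ∀ i, 0 < p i)
    (i : Fin m) :
    gateaux C.penalty p i =
      2 * ∑ j, (C.outProb p j - C.proj j (C.outProb p j)) * C.outGrad p j i := by
  refine HasDerivWithinAt.derivWithin (HasDerivAt.hasDerivWithinAt ?_)
    (uniqueDiffOn_Ici 0 0 (by simp))
  rw [Finset.mul_sum]
  unfold penalty
  refine HasDerivAt.fun_sum fun j _ => ?_
  have h1 := hasDerivAt_inputExp C.z_injective hp (C.ind j) i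
  have h2 := C.hasDerivAt_sq_sub_proj (h j) (C.outProb p j)
  rw [← mul_assoc]
  refine HasDerivAt.comp (h₂ := fun x => (x - C.proj j x) ^ 2) (0 : ℝ) ?_ h1
  have h3 : C.outProb ((1 - (0 : ℝ)) • p + (0 : ℝ) • (Pi.single i 1 : Fin m → ℝ)) j =
      C.outProb p j := by simp
  rw [h3]
  exact h2

theorem continuous_outProb (j : Fin n) : Continuous (fun p => C.outProb p j) :=
  (contDiff_inputExp C.z T (C.ind j)).continuous

theorem continuousOn_outGrad {ε : ℝ} (hε : 0 < ε) (j : Fin n) (i : Fin m) :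
    ContinuousOn (fun p => C.outGrad p j i) (restrictedSimplex m ε) :=
  (continuousOn_inputExp_score C.z_injective _ _).mono fun _ hp =>
    (pos_of_mem hε hp i).ne'

theorem continuousOn_gateaux_psi {ε : ℝ} (hε : 0 < ε) (i : Fin m) :
    ContinuousOn (fun p => gateaux C.psi p i) (restrictedSimplex m ε) :=
  ((continuousOn_inputExp_score C.z_injective C.g i).mono fun _ hp =>
    (pos_of_mem hε hp i).ne').congr fun _ hp =>
      C.gateaux_psi (pos_of_mem hε hp) i

theorem continuousOn_gateaux_penalty (h : ∀ j, C.lo j ≤ C.hi j) {ε : ℝ} (hε : 0 < ε)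
    (i : Fin m) :
    ContinuousOn (fun p => gateaux C.penalty p i) (restrictedSimplex m ε) := by
  have : ContinuousOn (fun p => 2 * ∑ j, (C.outProb p j - C.proj j (C.outProb p j)) *
      C.outGrad p j i) (restrictedSimplex m ε) := by
    refine continuousOn_const.mul (continuousOn_finsetSum _ fun j _ => ContinuousOn.mul ?_
      (C.continuousOn_outGrad hε j i))
    exact ((C.continuous_outProb j).sub
      ((C.continuous_proj (h j)).comp (C.continuous_outProb j))).continuousOn
  exact this.congr fun p hp => C.gateaux_penalty h (pos_of_mem hε hp) i

end Problem

/-! ### The Kullback-Leibler divergence on the restricted simplex -/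

section KullbackLeibler

/-- The Kullback-Leibler divergence of two vectors. -/
def kl {m : ℕ} (u p : Fin m → ℝ) : ℝ := ∑ i, u i * Real.log (u i / p i)

variable {m : ℕ}

theorem kl_self {p : Fin m → ℝ} (hp : ∀ i, 0 < p i) : kl p p = 0 := by
  simp [kl, (hp _).ne']

theorem kl_eq_sum_klFun {u p : Fin m → ℝ} (hp : ∀ i, 0 < p i) (h : ∑ i, u i = ∑ i, p i) :
    kl u p = ∑ i, p i * InformationTheory.klFun (u i / p i) := by
  have h1 : ∀ i, p i * InformationTheory.klFun (u i / p i) =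
      u i * Real.log (u i / p i) + p i - u i := by
    intro i
    have := (hp i).ne'
    rw [InformationTheory.klFun_apply]
    field_simp
  simp_rw [h1, Finset.sum_sub_distrib, Finset.sum_add_distrib, h, kl]
  ring

theorem kl_nonneg {u p : Fin m → ℝ} (hu : ∀ i, 0 ≤ u i) (hp : ∀ i, 0 < p i)
    (h : ∑ i, u i = ∑ i, p i) : 0 ≤ kl u p := by
  rw [kl_eq_sum_klFun hp h]
  exact Finset.sum_nonneg fun i _ => mul_nonneg (hp i).le
    (InformationTheory.klFun_nonneg (div_nonneg (hu i) (hp i).le))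

theorem eq_of_kl_eq_zero {u p : Fin m → ℝ} (hu : ∀ i, 0 ≤ u i) (hp : ∀ i, 0 < p i)
    (h : ∑ i, u i = ∑ i, p i) (h0 : kl u p = 0) : p = u := by
  rw [kl_eq_sum_klFun hp h, Finset.sum_eq_zero_iff_of_nonneg fun i _ => mul_nonneg (hp i).le
    (InformationTheory.klFun_nonneg (div_nonneg (hu i) (hp i).le))] at h0
  ext i
  have h1 := h0 i (Finset.mem_univ i)
  have h2 := (mul_eq_zero.1 h1).resolve_left (hp i).ne'
  rw [InformationTheory.klFun_eq_zero_iff (div_nonneg (hu i) (hp i).le),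
    div_eq_one_iff_eq (hp i).ne'] at h2
  exact h2.symm

/-- Convexity in the first argument: the two sides differ by exactly `kl v u`. -/
theorem kl_sub_kl_le {u v p : Fin m → ℝ} (hu : ∀ i, 0 < u i) (hv : ∀ i, 0 < v i)
    (hp : ∀ i, 0 < p i) (h : ∑ i, u i = ∑ i, v i) :
    kl u p - kl v p ≤ ∑ i, (u i - v i) * Real.log (u i / p i) := by
  have h1 := kl_nonneg (fun i => (hv i).le) hu h.symm
  have h2 : kl u p - kl v p = ∑ i, (u i - v i) * Real.log (u i / p i) - kl v u := by
    simp only [kl, ← Finset.sum_sub_distrib]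
    refine Finset.sum_congr rfl fun i _ => ?_
    rw [Real.log_div (hu i).ne' (hp i).ne', Real.log_div (hv i).ne' (hp i).ne',
      Real.log_div (hv i).ne' (hu i).ne']
    ring
  linarith

theorem abs_log_div_le {ε x y : ℝ} (hε : 0 < ε) (hx : ε ≤ x) (hx1 : x ≤ 1) (hy : ε ≤ y)
    (hy1 : y ≤ 1) : |Real.log (x / y)| ≤ -Real.log ε := by
  have hx0 := hε.trans_le hx
  have hy0 := hε.trans_le hy
  rw [Real.log_div hx0.ne' hy0.ne', abs_le]
  have := Real.log_le_log hε hx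
  have := Real.log_le_log hε hy
  have := Real.log_nonpos hx0.le hx1
  have := Real.log_nonpos hy0.le hy1
  constructor <;> linarith

theorem abs_kl_le {ε : ℝ} (hε : 0 < ε) {u p : Fin m → ℝ} (hu : u ∈ restrictedSimplex m ε)
    (hp : p ∈ restrictedSimplex m ε) : |kl u p| ≤ -Real.log ε := by
  calc |kl u p| ≤ ∑ i, |u i * Real.log (u i / p i)| := Finset.abs_sum_le_sum_abs _ _
    _ ≤ ∑ i, u i * -Real.log ε := by
        refine Finset.sum_le_sum fun i _ => ?_
        rw [abs_mul, abs_of_nonneg (hu.1.1 i)]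
        exact mul_le_mul_of_nonneg_left
          (abs_log_div_le hε (hu.2 i) (le_one_of_mem hu i) (hp.2 i) (le_one_of_mem hp i)) (hu.1.1 i)
    _ = -Real.log ε := by rw [← Finset.sum_mul, hu.1.2, one_mul]

/-- The price of moving the target of the Lyapunov function. It is Lipschitz because coordinates
bounded below by `ε` keep the log-ratios bounded. -/
theorem kl_sub_kl_le_norm {ε : ℝ} (hε : 0 < ε) {u v p : Fin m → ℝ}
    (hu : u ∈ restrictedSimplex m ε) (hv : v ∈ restrictedSimplex m ε)
    (hp : p ∈ restrictedSimplex m ε) :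
    kl u p - kl v p ≤ m * -Real.log ε * ‖u - v‖ := by
  refine (kl_sub_kl_le (pos_of_mem hε hu) (pos_of_mem hε hv) (pos_of_mem hε hp)
    (hu.1.2.trans hv.1.2.symm)).trans ?_
  calc ∑ i, (u i - v i) * Real.log (u i / p i) ≤ ∑ _i : Fin m, ‖u - v‖ * -Real.log ε := by
        refine Finset.sum_le_sum fun i _ => (le_abs_self _).trans ?_
        rw [abs_mul]
        exact mul_le_mul (norm_le_pi_norm (u - v) i)
          (abs_log_div_le hε (hu.2 i) (le_one_of_mem hu i) (hp.2 i) (le_one_of_mem hp i))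
          (abs_nonneg _)
          (norm_nonneg _)
    _ = m * -Real.log ε * ‖u - v‖ := by simp; ring

theorem continuousOn_kl {ε : ℝ} (hε : 0 < ε) :
    ContinuousOn (fun x : (Fin m → ℝ) × (Fin m → ℝ) => kl x.1 x.2)
      (restrictedSimplex m ε ×ˢ restrictedSimplex m ε) := by
  unfold kl
  refine continuousOn_finsetSum _ fun i _ => ContinuousOn.mul (by fun_prop) ?_
  refine ContinuousOn.log (ContinuousOn.div (by fun_prop) (by fun_prop) ?_) ?_
  · exact fun x hx => (pos_of_mem hε hx.2 i).ne'
  · exact fun x hx => (div_pos (pos_of_mem hε hx.1 i) (pos_of_mem hε hx.2 i)).ne'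

theorem measurable_kl (u : Fin m → ℝ) : Measurable (kl u) := by
  unfold kl
  fun_prop

end KullbackLeibler

/-! ### Sort-and-search as an entropic proximal step -/

section SortAndSearch

variable {m : ℕ}

theorem sorted_mono {w : Fin m → ℝ} {i j : ℕ} (hi : 1 ≤ i) (hij : i ≤ j) (hj : j ≤ m) :
    sorted w i ≤ sorted w j := by
  rw [sorted, sorted, dif_pos ⟨hi, hij.trans hj⟩, dif_pos ⟨hi.trans hij, hj⟩]
  exact Tuple.monotone_sort w (by simp only [Fin.mk_le_mk]; omega)

theorem sorted_pos {w : Fin m → ℝ} (hw : ∀ i, 0 < w i) {i : ℕ} (hi : 1 ≤ i) (him : i ≤ m) :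
    0 < sorted w i := by
  rw [sorted, dif_pos ⟨hi, him⟩]; exact hw _

theorem sum_eq_sum_sorted (w : Fin m → ℝ) (f : ℝ → ℝ) :
    ∑ l, f (w l) = ∑ l ∈ Finset.Ico 1 (m + 1), f (sorted w l) := by
  rw [← Equiv.sum_comp (Tuple.sort w), Finset.sum_Ico_eq_sum_range, Nat.add_sub_cancel,
    Finset.sum_range]
  refine Finset.sum_congr rfl fun l _ => ?_
  rw [sorted, dif_pos ⟨by omega, by omega⟩]
  congr 3
  ext; simp

/-- The sort-and-search procedure finds the level `η` at which the truncation takes effect. -/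
theorem SortSearch.exists_level {ε : ℝ} (hε : 0 < ε) (hεm : ε < 1 / m) {p ξ q : Fin m → ℝ}
    (hp : ∀ i, 0 < p i) (h : SortSearch ε p ξ q) :
    ∃ η Z : ℝ, 0 < η ∧ 0 < Z ∧ η = ε * Z ∧ (Z = ∑ i, max η (p i * Real.exp (-ξ i))) ∧
      ∀ i, q i = max η (p i * Real.exp (-ξ i)) / Z := by
  obtain ⟨i, him, h1, h2, h3⟩ := h
  have hw : ∀ i, 0 < p i * Real.exp (-ξ i) := fun i => mul_pos (hp i) (Real.exp_pos _)
  set w : Fin m → ℝ := fun i => p i * Real.exp (-ξ i)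
  set B := ∑ l ∈ Finset.Icc (i + 1) m, sorted w l with hB
  have hBs : B = sorted w (i + 1) + ∑ l ∈ Finset.Icc (i + 2) m, sorted w l := by
    have : Finset.Icc (i + 1) m = insert (i + 1) (Finset.Icc (i + 2) m) := by
      ext; simp; omega
    rw [hB, this, Finset.sum_insert (by simp)]
  have hB' : 0 ≤ ∑ l ∈ Finset.Icc (i + 2) m, sorted w l :=
    Finset.sum_nonneg fun l hl => (sorted_pos hw (by simp at hl; omega) (by simp at hl; omega)).le
  have hs1 : 0 < sorted w (i + 1) := sorted_pos hw (by omega) him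
  have hBpos : 0 < B := by linarith
  have hmpos : (0 : ℝ) < m := by exact_mod_cast (by omega : 0 < m)
  have hεi : 0 < 1 - ε * i := by
    have h4 : ε * m < 1 := (lt_div_iff₀ hmpos).1 hεm
    have h5 : (i : ℝ) < m := by exact_mod_cast him
    nlinarith
  set η : ℝ := ε * B / (1 - ε * i) with hη
  have hηpos : 0 < η := by positivity
  -- Rearranged, this reads `η = ε * (i * η + B)`: the level is `ε` times the normalizing constant,
  -- so truncated coordinates are normalized to exactly `ε`.
  have hηeq : η * (1 - ε * i) = ε * B := by rw [hη]; field_simp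
  have hlo : sorted w i ≤ η := by
    -- For `i = 0` nothing is truncated, and the default value `sorted w 0 = 0` makes the bound
    -- trivial.
    rcases Nat.eq_zero_or_pos i with h0 | h0
    · subst h0; simp only [sorted]; simpa using hηpos.le
    · have h5 := sorted_pos hw h0 him.le
      rw [div_le_iff₀ (by positivity)] at h1
      rw [hη, le_div_iff₀ hεi]
      linarith
  have hhi : η < sorted w (i + 1) := by
    rw [lt_div_iff₀ (by positivity)] at h2
    rw [hη, div_lt_iff₀ hεi, hBs]
    linarith
  have hZ : ∑ l, max η (w l) = i * η + B := by
    rw [sum_eq_sum_sorted w (max η), ← Finset.sum_Ico_consecutive _ (by omega : 1 ≤ i + 1)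
      (by omega : i + 1 ≤ m + 1)]
    congr 1
    · rw [Finset.sum_congr rfl (g := fun _ => η)]
      · simp
      · intro l hl
        rw [Finset.mem_Ico] at hl
        exact max_eq_left ((sorted_mono hl.1 (by omega) him.le).trans hlo)
    · refine Finset.sum_congr rfl fun l hl => ?_
      rw [Finset.mem_Icc] at hl
      exact max_eq_right (hhi.le.trans (sorted_mono (by omega) hl.1 hl.2))
  refine ⟨η, i * η + B, hηpos, by positivity, by linarith, hZ.symm, fun i' => ?_⟩
  rw [← hZ]
  exact h3 i'

theorem SortSearch.mem_restrictedSimplex {ε : ℝ} (hε : 0 < ε) (hεm : ε < 1 / m)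
    {p ξ q : Fin m → ℝ} (hp : ∀ i, 0 < p i) (h : SortSearch ε p ξ q) :
    q ∈ restrictedSimplex m ε := by
  obtain ⟨η, Z, hη, hZ, hηZ, hZs, hq⟩ := h.exists_level hε hεm hp
  have h1 : ∀ i, ε ≤ q i := fun i => by
    rw [hq, le_div_iff₀ hZ, ← hηZ]; exact le_max_left _ _
  refine ⟨⟨fun i => hε.le.trans (h1 i), ?_⟩, h1⟩
  simp_rw [hq, ← Finset.sum_div]
  rw [← hZs, div_self hZ.ne']

/-- The output of the sort-and-search procedure satisfies the optimality condition of the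
entropic proximal step over the restricted simplex. -/
theorem SortSearch.optimality {ε : ℝ} (hε : 0 < ε) (hεm : ε < 1 / m)
    {p ξ q : Fin m → ℝ} (hp : ∀ i, 0 < p i) (h : SortSearch ε p ξ q)
    {u : Fin m → ℝ} (hu : u ∈ restrictedSimplex m ε) :
    0 ≤ ∑ i, (u i - q i) * (Real.log (q i / p i) + ξ i) := by
  have hqs := h.mem_restrictedSimplex hε hεm hp
  obtain ⟨η, Z, hη, hZ, hηZ, hZs, hq⟩ := h.exists_level hε hεm hp
  -- These are the KKT conditions: the gradient is the constant `-log Z` plus a nonnegative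
  -- multiplier that is nonzero only where `q i = ε`, and there `u i ≥ q i`. The constant drops out
  -- because `u` and `q` have the same mass.
  have key : ∀ i, (u i - q i) * -Real.log Z ≤ (u i - q i) * (Real.log (q i / p i) + ξ i) := by
    intro i
    have hw : 0 < p i * Real.exp (-ξ i) := mul_pos (hp i) (Real.exp_pos _)
    have hlw : Real.log (p i * Real.exp (-ξ i)) = Real.log (p i) - ξ i := by
      rw [Real.log_mul (hp i).ne' (Real.exp_pos _).ne', Real.log_exp]; ring
    have hlq : Real.log (q i / p i) + ξ i = -Real.log Z +
        (Real.log (max η (p i * Real.exp (-ξ i))) - Real.log (p i * Real.exp (-ξ i))) := by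
      rw [hq, Real.log_div (by positivity) (hp i).ne', Real.log_div (by positivity) hZ.ne', hlw]
      ring
    rw [hlq, mul_add]
    rcases le_total η (p i * Real.exp (-ξ i)) with h1 | h1
    · rw [max_eq_right h1]; simp
    · have h2 : q i = ε := by rw [hq, max_eq_left h1, hηZ]; field_simp
      have h3 : 0 ≤ u i - q i := by rw [h2]; linarith [hu.2 i]
      have h4 := Real.log_le_log hw (le_max_right η (p i * Real.exp (-ξ i)))
      nlinarith [mul_nonneg h3 (sub_nonneg.2 h4)]
  calc (0 : ℝ) = ∑ i, (u i - q i) * -Real.log Z := by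
        rw [← Finset.sum_mul, Finset.sum_sub_distrib, hu.1.2, hqs.1.2]; simp
    _ ≤ _ := Finset.sum_le_sum fun i _ => key i

/-- The logarithm has slope at least one on `(0, 1]`. This is the strong monotonicity of the entropy
gradient. -/
theorem sub_sq_le_mul_log_sub_log {x y : ℝ} (hx : 0 < x) (hx1 : x ≤ 1) (hy : 0 < y)
    (hy1 : y ≤ 1) : (x - y) ^ 2 ≤ (x - y) * Real.log (x / y) := by
  have key : ∀ {a b : ℝ}, 0 < b → a ≤ 1 → b ≤ a → a - b ≤ Real.log (a / b) := by
    intro a b hb ha hab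
    have h0 : 0 < a := hb.trans_le hab
    have h1 := Real.one_sub_inv_le_log_of_pos (div_pos h0 hb)
    refine le_trans ?_ h1
    rw [inv_div]
    have : (a - b) * a ≤ a - b := by nlinarith
    have : 1 - b / a = (a - b) / a := by field_simp
    rw [this, le_div_iff₀ h0]
    assumption
  rcases le_total y x with h | h
  · nlinarith [key hy hx1 h]
  · have h1 := key hx hy1 h
    have h2 : Real.log (x / y) = -Real.log (y / x) := by rw [← Real.log_inv, inv_div]
    rw [h2]
    nlinarith

/-- The optimality condition is tested at the starting point `u = p`. -/
theorem SortSearch.sum_sq_le {ε : ℝ} (hε : 0 < ε) (hεm : ε < 1 / m)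
    {p ξ q : Fin m → ℝ} (hp : p ∈ restrictedSimplex m ε) (h : SortSearch ε p ξ q) :
    ∑ i, (p i - q i) ^ 2 ≤ ∑ i, ξ i * (p i - q i) := by
  have hq := h.mem_restrictedSimplex hε hεm (pos_of_mem hε hp)
  have h1 := h.optimality hε hεm (pos_of_mem hε hp) hp
  have h2 : ∑ i, (p i - q i) ^ 2 ≤ ∑ i, (p i - q i) * Real.log (p i / q i) :=
    Finset.sum_le_sum fun i _ => sub_sq_le_mul_log_sub_log (pos_of_mem hε hp i) (le_one_of_mem hp i)
      (pos_of_mem hε hq i) (le_one_of_mem hq i)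
  have h3 : ∑ i, (p i - q i) * (Real.log (q i / p i) + ξ i) =
      ∑ i, ξ i * (p i - q i) - ∑ i, (p i - q i) * Real.log (p i / q i) := by
    rw [← Finset.sum_sub_distrib]
    refine Finset.sum_congr rfl fun i _ => ?_
    rw [← inv_div, Real.log_inv]; ring
  linarith

theorem SortSearch.step_le {ε : ℝ} (hε : 0 < ε) (hεm : ε < 1 / m)
    {p ξ q : Fin m → ℝ} (hp : p ∈ restrictedSimplex m ε) (h : SortSearch ε p ξ q) :
    ∑ i, (p i - q i) ^ 2 ≤ ∑ i, ξ i ^ 2 := by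
  have h1 := h.sum_sq_le hε hεm hp
  have h2 : ∑ i, ξ i * (p i - q i) ≤ ∑ i, (ξ i ^ 2 / 2 + (p i - q i) ^ 2 / 2) :=
    Finset.sum_le_sum fun i _ => by nlinarith [sq_nonneg (ξ i - (p i - q i))]
  rw [Finset.sum_add_distrib, ← Finset.sum_div, ← Finset.sum_div] at h2
  linarith

/-- The mirror descent inequality: the three-point identity turns the optimality condition at `u`
into a comparison of divergences. The term `kl q p` is discarded, and `step_le` controls `∑ ξ (p -
q)`. -/
theorem SortSearch.kl_le {ε : ℝ} (hε : 0 < ε) (hεm : ε < 1 / m)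
    {p ξ q : Fin m → ℝ} (hp : p ∈ restrictedSimplex m ε) (h : SortSearch ε p ξ q)
    {u : Fin m → ℝ} (hu : u ∈ restrictedSimplex m ε) :
    kl u q ≤ kl u p - ∑ i, ξ i * (p i - u i) + ∑ i, ξ i ^ 2 := by
  have hq := h.mem_restrictedSimplex hε hεm (pos_of_mem hε hp)
  have h1 := h.optimality hε hεm (pos_of_mem hε hp) hu
  have h2 := kl_nonneg hq.1.1 (pos_of_mem hε hp) (hq.1.2.trans hp.1.2.symm)
  have h3 := h.step_le hε hεm hp
  have h4 : ∑ i, (u i - q i) * (Real.log (q i / p i) + ξ i) =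
      kl u p - kl u q - kl q p - ∑ i, ξ i * (p i - u i) + ∑ i, ξ i * (p i - q i) := by
    simp only [kl, ← Finset.sum_sub_distrib, ← Finset.sum_add_distrib]
    refine Finset.sum_congr rfl fun i _ => ?_
    have := (pos_of_mem hε hp i).ne'
    have := (pos_of_mem hε hq i).ne'
    have := (pos_of_mem hε hu i).ne'
    rw [Real.log_div, Real.log_div, Real.log_div] <;> try assumption
    ring
  have h5 : ∑ i, ξ i * (p i - q i) ≤ ∑ i, (ξ i ^ 2 / 2 + (p i - q i) ^ 2 / 2) :=
    Finset.sum_le_sum fun i _ => by nlinarith [sq_nonneg (ξ i - (p i - q i))]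
  rw [Finset.sum_add_distrib, ← Finset.sum_div, ← Finset.sum_div] at h5
  linarith

end SortAndSearch

/-! ### Summability from recursions and from bounded variation -/

section Series

/-- Multiplying the recursion by the decreasing weight `u k` keeps it telescoping, since `u (k + 1)
* x (k + 1) ≤ u k * x (k + 1)`. -/
theorem summable_of_recursion {x c u r : ℕ → ℝ} (hx : ∀ k, 0 ≤ x k) (hc : ∀ k, 0 ≤ c k)
    (hu : ∀ k, 0 ≤ u k) (hu' : Antitone u) (hr : Summable fun k => u k * r k)
    (hr0 : ∀ k, 0 ≤ r k) (hrec : ∀ k, x (k + 1) ≤ x k - c k * x k + r k) :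
    Summable fun k => u k * (c k * x k) := by
  have key : ∀ N, u N * x N + ∑ k ∈ Finset.range N, u k * (c k * x k) ≤
      u 0 * x 0 + ∑ k ∈ Finset.range N, u k * r k := by
    intro N
    induction N with
    | zero => simp
    | succ N ih =>
      rw [Finset.sum_range_succ, Finset.sum_range_succ]
      have h1 := mul_le_mul_of_nonneg_right (hu' N.le_succ) (hx (N + 1))
      have h2 := mul_le_mul_of_nonneg_left (hrec N) (hu N)
      simp only [Nat.succ_eq_add_one] at h1
      linarith
  refine summable_of_sum_range_le (c := u 0 * x 0 + ∑' k, u k * r k)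
    (fun k => mul_nonneg (hu k) (mul_nonneg (hc k) (hx k))) fun N => ?_
  have h1 := hr.sum_le_tsum (Finset.range N) fun k _ => mul_nonneg (hu k) (hr0 k)
  have h2 := mul_nonneg (hu N) (hx N)
  linarith [key N]

theorem summable_succ_rpow {r : ℝ} (hr : r < -1) :
    Summable fun k : ℕ => ((k : ℝ) + 1) ^ r := by
  have := (summable_nat_add_iff 1).2 (Real.summable_nat_rpow.2 hr)
  simpa using this

/-- The weighted mean square tracking errors are summable. -/
theorem exists_summable_weighted_of_recursion {α₁ α₂ b C : ℝ} (hb : 0 < b) (hC : 0 ≤ C)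
    (h₁ : 2 - 2 * α₁ < α₂) (h₂ : α₂ < 2 * α₁ - 1) {x : ℕ → ℝ} (hx : ∀ k, 0 ≤ x k)
    (hrec : ∀ k : ℕ, x (k + 1) ≤ x k - (b * ((k : ℝ) + 1) ^ (-α₂)) * x k +
      C * (((k : ℝ) + 1) ^ (-2 * α₂) + ((k : ℝ) + 1) ^ (-2 * α₁ + α₂))) :
    ∃ δ > 0, Summable fun k : ℕ => ((k : ℝ) + 1) ^ (1 + δ - 2 * α₁) * x k := by
  -- The first gap makes the weight exponent `1 + δ - 2 * α₁ + α₂` negative and the weighted `γ²/β`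
  -- term summable; the second makes the weighted `β²` term summable. Half the minimum stays
  -- strictly below both.
  set δ := min (2 * α₁ - 1 - α₂) (2 * α₁ + α₂ - 2) / 2 with hδ
  have hδ1 : δ < 2 * α₁ - 1 - α₂ := by
    have := min_le_left (2 * α₁ - 1 - α₂) (2 * α₁ + α₂ - 2); rw [hδ]; linarith
  have hδ2 : δ < 2 * α₁ + α₂ - 2 := by
    have := min_le_right (2 * α₁ - 1 - α₂) (2 * α₁ + α₂ - 2); rw [hδ]; linarith
  have hδ0 : 0 < δ := by
    have : 0 < min (2 * α₁ - 1 - α₂) (2 * α₁ + α₂ - 2) := lt_min (by linarith) (by linarith)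
    rw [hδ]; linarith
  refine ⟨δ, hδ0, ?_⟩
  have hpos : ∀ k : ℕ, (0 : ℝ) < (k : ℝ) + 1 := fun k => by positivity
  have h := summable_of_recursion (x := x) (c := fun k : ℕ => b * ((k : ℝ) + 1) ^ (-α₂))
    (u := fun k : ℕ => ((k : ℝ) + 1) ^ (1 + δ - 2 * α₁ + α₂))
    (r := fun k : ℕ => C * (((k : ℝ) + 1) ^ (-2 * α₂) + ((k : ℝ) + 1) ^ (-2 * α₁ + α₂)))
    hx (fun k => by positivity) (fun k => by positivity) ?_ ?_ (fun k => by positivity) hrec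
  · have h3 := h.mul_left b⁻¹
    refine h3.congr fun k => ?_
    have h4 : ((k : ℝ) + 1) ^ (1 + δ - 2 * α₁) =
        ((k : ℝ) + 1) ^ (1 + δ - 2 * α₁ + α₂) * ((k : ℝ) + 1) ^ (-α₂) := by
      rw [← Real.rpow_add (hpos k)]; congr 1; ring
    rw [h4]; field_simp
  · intro k l hkl
    refine Real.rpow_le_rpow_of_nonpos (hpos k) ?_ (by linarith)
    have : (k : ℝ) ≤ l := by exact_mod_cast hkl
    linarith
  · have h5 : Summable fun k : ℕ => C * (((k : ℝ) + 1) ^ (1 + δ - 2 * α₁ - α₂) +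
        ((k : ℝ) + 1) ^ (1 + δ - 4 * α₁ + 2 * α₂)) :=
      ((summable_succ_rpow (by linarith)).add (summable_succ_rpow (by linarith))).mul_left C
    refine h5.congr fun k => ?_
    have h6 : ((k : ℝ) + 1) ^ (1 + δ - 2 * α₁ - α₂) =
        ((k : ℝ) + 1) ^ (1 + δ - 2 * α₁ + α₂) * ((k : ℝ) + 1) ^ (-2 * α₂) := by
      rw [← Real.rpow_add (hpos k)]; congr 1; ring
    have h7 : ((k : ℝ) + 1) ^ (1 + δ - 4 * α₁ + 2 * α₂) =
        ((k : ℝ) + 1) ^ (1 + δ - 2 * α₁ + α₂) * ((k : ℝ) + 1) ^ (-2 * α₁ + α₂) := by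
      rw [← Real.rpow_add (hpos k)]; congr 1; ring
    rw [h6, h7]; ring

theorem summable_norm_sub_of_boundedVariationOn {E : Type*} [SeminormedAddCommGroup E]
    {f : ℝ → E} {s : Set ℝ} (hf : BoundedVariationOn f s) {u : ℕ → ℝ} (hu : Antitone u)
    (hus : ∀ k, u k ∈ s) : Summable fun k => ‖f (u (k + 1)) - f (u k)‖ := by
  have h1 : ∀ N, ∑ k ∈ Finset.range N, edist (f (u (k + 1))) (f (u k)) ≤ eVariationOn f s := by
    intro N
    -- The variation is defined through increasing sequences; the decreasing `u` becomes increasing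
    -- in the order dual.
    rw [← eVariationOn.comp_ofDual f s]
    exact eVariationOn.sum_le (f := f ∘ OrderDual.ofDual) (u := fun k => OrderDual.toDual (u k))
      (fun i j hij => hu hij) hus
  refine summable_of_sum_range_le (c := (eVariationOn f s).toReal) (fun k => norm_nonneg _)
    fun N => ?_
  have h2 : ∑ k ∈ Finset.range N, ‖f (u (k + 1)) - f (u k)‖ =
      (∑ k ∈ Finset.range N, edist (f (u (k + 1))) (f (u k))).toReal := by
    rw [ENNReal.toReal_sum fun k _ => edist_ne_top _ _]
    simp [edist_dist, dist_eq_norm]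
  rw [h2]
  exact ENNReal.toReal_mono hf (h1 N)

end Series

/-! ### The Robbins-Siegmund theorem -/

section Probability

variable {Ω : Type*} {mΩ : MeasurableSpace Ω} {μ : Measure Ω}

theorem ae_summable_of_summable_integral {B : ℕ → Ω → ℝ} (hBi : ∀ k, Integrable (B k) μ)
    (hB0 : ∀ k ω, 0 ≤ B k ω) (hB : Summable fun k => ∫ ω, B k ω ∂μ) :
    ∀ᵐ ω ∂μ, Summable fun k => B k ω := by
  have h1 : ∫⁻ ω, ∑' k, ENNReal.ofReal (B k ω) ∂μ ≠ ⊤ := by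
    rw [lintegral_tsum fun k => (hBi k).aemeasurable.ennreal_ofReal]
    have : ∀ k, ∫⁻ ω, ENNReal.ofReal (B k ω) ∂μ = ENNReal.ofReal (∫ ω, B k ω ∂μ) := fun k =>
      (ofReal_integral_eq_lintegral_ofReal (hBi k) (ae_of_all _ (hB0 k))).symm
    simp_rw [this]
    rw [← ENNReal.ofReal_tsum_of_nonneg (fun k => integral_nonneg (hB0 k)) hB]
    exact ENNReal.ofReal_ne_top
  have h2 := ae_lt_top' (AEMeasurable.tsum
    fun k => (hBi k).aemeasurable.ennreal_ofReal) h1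
  filter_upwards [h2] with ω hω
  have := ENNReal.summable_toReal hω.ne
  simpa [ENNReal.toReal_ofReal (hB0 _ ω)] using this

/-- The Robbins-Siegmund theorem on nonnegative almost supermartingales. -/
theorem ae_summable_and_tendsto_of_almost_supermartingale [IsFiniteMeasure μ]
    {ℱ : Filtration ℕ mΩ} {V A B : ℕ → Ω → ℝ}
    (hVm : ∀ k, StronglyMeasurable[ℱ k] (V k)) (hAm : ∀ k, StronglyMeasurable[ℱ k] (A k))
    (hBm : ∀ k, StronglyMeasurable[ℱ k] (B k)) (hVi : ∀ k, Integrable (V k) μ)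
    (hAi : ∀ k, Integrable (A k) μ) (hBi : ∀ k, Integrable (B k) μ)
    (hV0 : ∀ k ω, 0 ≤ V k ω) (hA0 : ∀ k ω, 0 ≤ A k ω) (hB0 : ∀ k ω, 0 ≤ B k ω)
    (hstep : ∀ k, μ[V (k + 1) | ℱ k] ≤ᵐ[μ] fun ω => V k ω - A k ω + B k ω)
    (hB : Summable fun k => ∫ ω, B k ω ∂μ) :
    ∀ᵐ ω ∂μ, (Summable fun k => A k ω) ∧ ∃ c, Tendsto (fun k => V k ω) atTop (𝓝 c) := by
  -- Adding the compensator makes `V + W` a supermartingale. The sum stops before `k`, so `W (k +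
  -- 1)` is already known at time `k`.
  set W : ℕ → Ω → ℝ := fun k => ∑ j ∈ Finset.range k, (A j - B j) with hW
  have hWi : ∀ k, Integrable (W k) μ := fun k =>
    integrable_finsetSum' _ fun j _ => (hAi j).sub (hBi j)
  have hWm : ∀ k l, k ≤ l + 1 → StronglyMeasurable[ℱ l] (W k) := fun k l hkl =>
    Finset.stronglyMeasurable_sum _ fun j hj =>
      ((hAm j).sub (hBm j)).mono (ℱ.mono (by rw [Finset.mem_range] at hj; omega))
  set U : ℕ → Ω → ℝ := fun k => V k + W k with hU
  have hUi : ∀ k, Integrable (U k) μ := fun k => (hVi k).add (hWi k)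
  have hsup : Supermartingale U ℱ μ := by
    refine supermartingale_nat (fun k => (hVm k).add (hWm k k k.le_succ)) hUi fun k => ?_
    have h1 : μ[U (k + 1) | ℱ k] =ᵐ[μ] μ[V (k + 1) | ℱ k] + μ[W (k + 1) | ℱ k] :=
      condExp_add (hVi _) (hWi _) _
    rw [condExp_of_stronglyMeasurable (ℱ.le k) (hWm (k + 1) k le_rfl) (hWi _)] at h1
    filter_upwards [h1, hstep k] with ω h2 h3
    rw [h2]
    simp only [hU, hW, Pi.add_apply, Finset.sum_range_succ, Pi.sub_apply]
    linarith
  have hanti : ∀ k, ∫ ω, U k ω ∂μ ≤ ∫ ω, U 0 ω ∂μ := by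
    intro k
    have := hsup.setIntegral_le (Nat.zero_le k) MeasurableSet.univ
    simpa using this
  have hUapp : ∀ k ω, U k ω = V k ω + ∑ j ∈ Finset.range k, A j ω -
      ∑ j ∈ Finset.range k, B j ω := by
    intro k ω
    simp only [hU, hW, Pi.add_apply, Finset.sum_apply, Pi.sub_apply, Finset.sum_sub_distrib]
    ring
  -- Since `U k ≥ -∑ B`, one has `|U k| ≤ U k + 2 ∑ B`, and the mean of the right side is bounded.
  have hbdd : ∀ k, eLpNorm ((-U) k) 1 μ ≤
      ((∫ ω, U 0 ω ∂μ + 2 * ∑' j, ∫ ω, B j ω ∂μ).toNNReal : ENNReal) := by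
    intro k
    have hSi : Integrable (fun ω => ∑ j ∈ Finset.range k, B j ω) μ :=
      integrable_finsetSum _ fun j _ => hBi j
    have hnegi : Integrable ((-U) k) μ := (hUi k).neg
    rw [eLpNorm_one_eq_lintegral_enorm, ← ofReal_integral_norm_eq_lintegral_enorm hnegi]
    refine ENNReal.ofReal_le_ofReal ?_
    calc ∫ ω, ‖(-U) k ω‖ ∂μ ≤ ∫ ω, (U k ω + 2 * ∑ j ∈ Finset.range k, B j ω) ∂μ := by
          refine integral_mono (hUi k).neg.norm ((hUi k).add (hSi.const_mul 2)) fun ω => ?_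
          have h1 : 0 ≤ ∑ j ∈ Finset.range k, B j ω := Finset.sum_nonneg fun j _ => hB0 j ω
          have h2 : 0 ≤ ∑ j ∈ Finset.range k, A j ω := Finset.sum_nonneg fun j _ => hA0 j ω
          have h3 := hV0 k ω
          have h4 := hUapp k ω
          change ‖-U k ω‖ ≤ _
          rw [norm_neg, Real.norm_eq_abs, abs_le]
          constructor <;> linarith
      _ = ∫ ω, U k ω ∂μ + 2 * ∑ j ∈ Finset.range k, ∫ ω, B j ω ∂μ := by
          rw [integral_add (hUi k) (hSi.const_mul 2), integral_const_mul,
            integral_finsetSum _ fun j _ => hBi j]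
      _ ≤ _ := by
          have h5 := hB.sum_le_tsum (Finset.range k) fun j _ => integral_nonneg (hB0 j)
          linarith [hanti k]
  filter_upwards [hsup.neg.exists_ae_tendsto_of_bdd hbdd,
    ae_summable_of_summable_integral hBi hB0 hB] with ω h1 h2
  obtain ⟨c, hc⟩ := h1
  have h3 : Tendsto (fun k => V k ω + ∑ j ∈ Finset.range k, A j ω) atTop
      (𝓝 (-c + ∑' j, B j ω)) := by
    refine (hc.neg.add h2.hasSum.tendsto_sum_nat).congr fun k => ?_
    have := hUapp k ω
    simp only [Pi.neg_apply, neg_neg]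
    linarith
  have h4 : Summable fun k => A k ω := by
    obtain ⟨M, hM⟩ := h3.bddAbove_range
    refine summable_of_sum_range_le (c := M) (fun k => hA0 k ω) fun N => ?_
    have := hM (Set.mem_range_self N)
    linarith [hV0 N ω]
  refine ⟨h4, _, (h3.sub h4.hasSum.tendsto_sum_nat).congr fun k => ?_⟩
  simp

end Probability

/-! ### Conditional expectations over a finite almost sure partition -/

section FinitePartition

variable {Ω : Type*} {m₀ mΩ : MeasurableSpace Ω} {μ : Measure Ω}
variable {J : Type*} [Fintype J] {E : J → Set Ω} {π : J → Ω → ℝ}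

/-- The disjoint cells have total probability `∫ ∑ π = 1`. For a run, this is how simulated values
outside the support points are excluded, and only almost surely. -/
theorem ae_exists_mem_of_condExp [IsProbabilityMeasure μ] (hm : m₀ ≤ mΩ)
    (hE : ∀ j, MeasurableSet (E j)) (hdisj : Pairwise (Function.onFun Disjoint E))
    (hπ : ∀ j, μ⟦E j | m₀⟧ =ᵐ[μ] π j) (hsum : ∀ ω, ∑ j, π j ω = 1) :
    ∀ᵐ ω ∂μ, ∃ j, ω ∈ E j := by
  have hπi : ∀ j, Integrable (π j) μ := fun j => integrable_condExp.congr (hπ j)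
  have h1 : ∀ j, μ.real (E j) = ∫ ω, π j ω ∂μ := fun j => by
    rw [← integral_congr_ae (hπ j), integral_condExp hm]
    exact (integral_indicator_one (hE j)).symm
  have h2 : μ.real (⋃ j, E j) = 1 := by
    rw [measureReal_iUnion_fintype hdisj hE]
    simp_rw [h1]
    rw [← integral_finsetSum _ fun j _ => hπi j]
    simp [hsum]
  have h3 : μ (⋃ j, E j) = 1 := by
    rw [measureReal_def, ENNReal.toReal_eq_one_iff] at h2; exact h2
  have h4 := (mem_ae_iff_prob_eq_one (MeasurableSet.iUnion hE)).2 h3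
  filter_upwards [h4] with ω hω
  exact Set.mem_iUnion.1 hω

/-- Conditional expectation of a quantity that, on each cell of an almost sure finite partition
with known conditional probabilities, agrees with a variable known given the past. -/
theorem integrable_and_condExp_of_partition [IsProbabilityMeasure μ] (hm : m₀ ≤ mΩ)
    (hE : ∀ j, MeasurableSet (E j)) (hdisj : Pairwise (Function.onFun Disjoint E))
    (hπ : ∀ j, μ⟦E j | m₀⟧ =ᵐ[μ] π j) (hsum : ∀ ω, ∑ j, π j ω = 1)
    {f : J → Ω → ℝ} (hf : ∀ j, StronglyMeasurable[m₀] (f j)) {K : ℝ} (hK : ∀ j ω, |f j ω| ≤ K)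
    {Y : Ω → ℝ} (hY : ∀ j, ∀ ω ∈ E j, Y ω = f j ω) :
    Integrable Y μ ∧ μ[Y | m₀] =ᵐ[μ] fun ω => ∑ j, π j ω * f j ω := by
  have hI : ∀ j, Integrable ((E j).indicator fun _ => (1 : ℝ)) μ := fun j =>
    (integrable_const 1).indicator (hE j)
  have hFI : ∀ j, Integrable (f j * (E j).indicator fun _ => (1 : ℝ)) μ := fun j =>
    (hI j).bdd_mul ((hf j).mono hm).aestronglyMeasurable (c := K) (ae_of_all _ (hK j))
  have hYe : Y =ᵐ[μ] ∑ j, f j * (E j).indicator fun _ => (1 : ℝ) := by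
    filter_upwards [ae_exists_mem_of_condExp hm hE hdisj hπ hsum] with ω ⟨j, hj⟩
    rw [Finset.sum_apply, Finset.sum_eq_single j, Pi.mul_apply, Set.indicator_of_mem hj, mul_one]
    · exact hY j ω hj
    · intro i _ hij
      have : ω ∉ E i := fun hi => Set.disjoint_left.1 (hdisj hij) hi hj
      simp [this]
    · simp
  have hSI := integrable_finsetSum' Finset.univ fun j _ => hFI j
  refine ⟨hSI.congr hYe.symm, ?_⟩
  refine (condExp_congr_ae hYe).trans ((condExp_finsetSum (fun j _ => hFI j) m₀).trans ?_)
  have h1 : ∀ j, μ[f j * (E j).indicator fun _ => (1 : ℝ) | m₀] =ᵐ[μ] f j * π j := fun j =>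
    (condExp_stronglyMeasurable_mul_of_bound hm (hf j) (hI j) K (ae_of_all _ (hK j))).trans
      ((EventuallyEq.refl _ (f j)).mul (hπ j))
  filter_upwards [ae_all_iff.2 h1] with ω hω
  rw [Finset.sum_apply]
  exact Finset.sum_congr rfl fun j _ => by rw [hω j, Pi.mul_apply, mul_comm]

end FinitePartition

/-- The possible outcomes of the simulations of one iteration, as indices of support points. -/
abbrev BatchIndex (m T S M₁ M₂ M₃ : ℕ) : Type :=
  (Fin M₁ → Fin T → Fin m) × (Fin M₂ → Fin T → Fin m) × (Fin M₃ → Fin S → Fin m)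

/-! ### Outcomes of one iteration and their probabilities -/

namespace BatchIndex

variable {m T S M₁ M₂ M₃ : ℕ}

/-- The probability of an outcome of the simulations under the input distribution `p`. -/
def weight (p : Fin m → ℝ) (j : BatchIndex m T S M₁ M₂ M₃) : ℝ :=
  (∏ r, ∏ t, p (j.1 r t)) * (∏ r, ∏ t, p (j.2.1 r t)) * (∏ r, ∏ t, p (j.2.2 r t))

/-- Independence of the three batches, as a factorization of finite sums. -/
theorem sum_weight_mul (p : Fin m → ℝ) (f : (Fin M₁ → Fin T → Fin m) → ℝ)
    (g : (Fin M₂ → Fin T → Fin m) → ℝ) (h : (Fin M₃ → Fin S → Fin m) → ℝ) :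
    ∑ j : BatchIndex m T S M₁ M₂ M₃, weight p j * (f j.1 * g j.2.1 * h j.2.2) =
      (∑ x, (∏ r, ∏ t, p (x r t)) * f x) * (∑ x, (∏ r, ∏ t, p (x r t)) * g x) *
        (∑ x, (∏ r, ∏ t, p (x r t)) * h x) := by
  rw [mul_assoc, Finset.sum_mul_sum, Finset.sum_mul_sum]
  simp only [Fintype.sum_prod_type, Finset.mul_sum, weight]
  refine Finset.sum_congr rfl fun a _ => Finset.sum_congr rfl fun b _ =>
    Finset.sum_congr rfl fun c _ => ?_
  ring

theorem sum_batch_eq_one {p : Fin m → ℝ} (hp : ∑ i, p i = 1) (M L : ℕ) :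
    ∑ x : Fin M → Fin L → Fin m, ∏ r, ∏ t, p (x r t) = 1 :=
  sum_prod_eq_one (w := fun ι : Fin L → Fin m => ∏ t, p (ι t)) (sum_prod_eq_one hp)

theorem sum_weight {p : Fin m → ℝ} (hp : ∑ i, p i = 1) :
    ∑ j : BatchIndex m T S M₁ M₂ M₃, weight p j = 1 := by
  have := sum_weight_mul (M₁ := M₁) (M₂ := M₂) (M₃ := M₃) (T := T) (S := S) p
    (fun _ => 1) (fun _ => 1) (fun _ => 1)
  simpa [sum_batch_eq_one hp] using this

theorem sum_weight_mul_fst {p : Fin m → ℝ} (hp : ∑ i, p i = 1)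
    (f : (Fin M₁ → Fin T → Fin m) → ℝ) :
    ∑ j : BatchIndex m T S M₁ M₂ M₃, weight p j * f j.1 =
      ∑ x, (∏ r, ∏ t, p (x r t)) * f x := by
  have := sum_weight_mul (M₁ := M₁) (M₂ := M₂) (M₃ := M₃) (T := T) (S := S) p
    f (fun _ => 1) (fun _ => 1)
  simpa [sum_batch_eq_one hp] using this

theorem sum_weight_mul_snd {p : Fin m → ℝ} (hp : ∑ i, p i = 1)
    (f : (Fin M₂ → Fin T → Fin m) → ℝ) :
    ∑ j : BatchIndex m T S M₁ M₂ M₃, weight p j * f j.2.1 =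
      ∑ x, (∏ r, ∏ t, p (x r t)) * f x := by
  have := sum_weight_mul (M₁ := M₁) (M₂ := M₂) (M₃ := M₃) (T := T) (S := S) p
    (fun _ => 1) f (fun _ => 1)
  simpa [sum_batch_eq_one hp] using this

theorem sum_weight_mul_thd {p : Fin m → ℝ} (hp : ∑ i, p i = 1)
    (f : (Fin M₃ → Fin S → Fin m) → ℝ) :
    ∑ j : BatchIndex m T S M₁ M₂ M₃, weight p j * f j.2.2 =
      ∑ x, (∏ r, ∏ t, p (x r t)) * f x := by
  have := sum_weight_mul (M₁ := M₁) (M₂ := M₂) (M₃ := M₃) (T := T) (S := S) p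
    (fun _ => 1) (fun _ => 1) f
  simpa [sum_batch_eq_one hp] using this

end BatchIndex

/-! ### Means, measurability and bounds of the estimators -/

namespace Problem

variable {𝒳 : Type*} {m n T S M M₁ M₂ M₃ : ℕ} (C : Problem 𝒳 m n T S)

/-- The input sequences with given indices of support points. -/
def points {L : ℕ} (x : Fin M → Fin L → Fin m) : Fin M → Fin L → 𝒳 :=
  fun r t => C.z (x r t)

theorem points_injective {L : ℕ} : Function.Injective (C.points (M := M) (L := L)) := by
  intro x y h
  ext r t : 2
  exact C.z_injective (congrFun (congrFun h r) t)

theorem sum_batch_mul_average {L : ℕ} (hM : 0 < M) {p : Fin m → ℝ} (hp : ∑ i, p i = 1)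
    (f : (Fin L → 𝒳) → ℝ) :
    ∑ x : Fin M → Fin L → Fin m, (∏ r, ∏ t, p (x r t)) *
      ((1 / (M : ℝ)) * ∑ r, f (C.points x r)) = inputExp C.z L p f :=
  sum_prod_mul_average hM (w := fun ι : Fin L → Fin m => ∏ t, p (ι t)) (sum_prod_eq_one hp)
    fun ι => f fun t => C.z (ι t)

theorem sum_batch_mul_sum {L : ℕ} {p : Fin m → ℝ} (hp : ∑ i, p i = 1)
    (f : (Fin L → 𝒳) → ℝ) :
    ∑ x : Fin M → Fin L → Fin m, (∏ r, ∏ t, p (x r t)) * (∑ r, f (C.points x r)) =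
      M * inputExp C.z L p f :=
  sum_prod_mul_sum (w := fun ι : Fin L → Fin m => ∏ t, p (ι t)) (sum_prod_eq_one hp)
    fun ι => f fun t => C.z (ι t)

theorem sum_weight_mul_psiHat (hM₃ : 0 < M₃) {p : Fin m → ℝ} (hp : ∑ i, p i = 1)
    (hp0 : ∀ i, 0 < p i) (i : Fin m) :
    ∑ j : BatchIndex m T S M₁ M₂ M₃, j.weight p * C.psiHat p (C.points j.2.2) i =
      gateaux C.psi p i := by
  rw [BatchIndex.sum_weight_mul_thd hp fun x => C.psiHat p (C.points x) i, C.gateaux_psi hp0]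
  exact C.sum_batch_mul_average hM₃ hp fun x => C.g x * score C.z p i x

/-- The mean of the product is the product of the means because the two factors use different
batches. The result is the gradient of the penalty with `s` in place of the projected probabilities.
-/
theorem sum_weight_mul_phiPHat (hM₁ : 0 < M₁) (hM₂ : 0 < M₂) {p : Fin m → ℝ}
    (hp : ∑ i, p i = 1) (s : Fin n → ℝ) (i : Fin m) :
    ∑ j : BatchIndex m T S M₁ M₂ M₃,
        j.weight p * C.phiPHat p s (C.points j.1) (C.points j.2.1) i =
      2 * ∑ l, (C.outProb p l - s l) * C.outGrad p l i := by
  have h1 : ∀ j : BatchIndex m T S M₁ M₂ M₃,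
      j.weight p * C.phiPHat p s (C.points j.1) (C.points j.2.1) i =
      2 * ∑ l, j.weight p *
        (((1 / (M₁ : ℝ)) * ∑ r, (C.ind l (C.points j.1 r) - s l)) *
        ((1 / (M₂ : ℝ)) * ∑ r, C.ind l (C.points j.2.1 r) *
          score C.z p i (C.points j.2.1 r)) * 1) := by
    intro j
    rw [phiPHat, ← Finset.mul_sum]
    simp only [mul_one]
    ring
  simp_rw [h1]
  rw [← Finset.mul_sum, Finset.sum_comm]
  congr 1
  refine Finset.sum_congr rfl fun l _ => ?_
  rw [BatchIndex.sum_weight_mul p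
    (fun x => (1 / (M₁ : ℝ)) * ∑ r, (C.ind l (C.points x r) - s l))
    (fun x => (1 / (M₂ : ℝ)) * ∑ r, C.ind l (C.points x r) * score C.z p i (C.points x r))
    (fun _ => 1)]
  have h2 := C.sum_batch_mul_average hM₁ hp fun x => C.ind l x - s l
  have h3 := C.sum_batch_mul_average hM₂ hp fun x => C.ind l x * score C.z p i x
  rw [h2, h3, inputExp_sub_const hp]
  simp only [mul_one, BatchIndex.sum_batch_eq_one hp]
  rfl

/-- The pooled estimator of the `l`-th output probability. -/
def outHat (X : Fin M₁ → Fin T → 𝒳) (X' : Fin M₂ → Fin T → 𝒳) (l : Fin n) : ℝ :=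
  (∑ r, C.ind l (X r) + ∑ r, C.ind l (X' r)) / (M₁ + M₂)

/-- In this form the slack update is a projected step of relative length `2β` towards an estimate of
the output probability. -/
theorem phiSHat_eq (hM₁ : 0 < M₁) (s : Fin n → ℝ) (X : Fin M₁ → Fin T → 𝒳)
    (X' : Fin M₂ → Fin T → 𝒳) (l : Fin n) :
    C.phiSHat s X X' l = -2 * (C.outHat X X' l - s l) := by
  have : (0 : ℝ) < (M₁ : ℝ) + M₂ := by positivity
  simp only [phiSHat, outHat, Finset.sum_sub_distrib, Finset.sum_const, Finset.card_univ,
    Fintype.card_fin, nsmul_eq_mul]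
  field_simp
  ring

theorem sum_weight_mul_outHat (hM₁ : 0 < M₁) {p : Fin m → ℝ} (hp : ∑ i, p i = 1)
    (l : Fin n) :
    ∑ j : BatchIndex m T S M₁ M₂ M₃,
        j.weight p * C.outHat (C.points j.1) (C.points j.2.1) l = C.outProb p l := by
  have : (0 : ℝ) < (M₁ : ℝ) + M₂ := by positivity
  have h1 : ∀ j : BatchIndex m T S M₁ M₂ M₃,
      j.weight p * C.outHat (C.points j.1) (C.points j.2.1) l =
      (j.weight p * (∑ r, C.ind l (C.points j.1 r)) +
        j.weight p * (∑ r, C.ind l (C.points j.2.1 r))) / (M₁ + M₂) := by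
    intro j; rw [outHat]; ring
  simp_rw [h1, ← Finset.sum_div, Finset.sum_add_distrib]
  rw [BatchIndex.sum_weight_mul_fst hp fun x => ∑ r, C.ind l (C.points x r),
    BatchIndex.sum_weight_mul_snd hp fun x => ∑ r, C.ind l (C.points x r),
    C.sum_batch_mul_sum hp, C.sum_batch_mul_sum hp, outProb]
  field_simp

theorem ind_nonneg (l : Fin n) (x : Fin T → 𝒳) : 0 ≤ C.ind l x := by
  unfold ind; split_ifs <;> norm_num

theorem ind_le_one (l : Fin n) (x : Fin T → 𝒳) : C.ind l x ≤ 1 := by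
  unfold ind; split_ifs <;> norm_num

theorem outHat_mem (hM₁ : 0 < M₁) (X : Fin M₁ → Fin T → 𝒳) (X' : Fin M₂ → Fin T → 𝒳)
    (l : Fin n) : 0 ≤ C.outHat X X' l ∧ C.outHat X X' l ≤ 1 := by
  have : (0 : ℝ) < (M₁ : ℝ) + M₂ := by positivity
  unfold outHat
  rw [div_le_one this]
  refine ⟨div_nonneg (add_nonneg ?_ ?_) this.le, add_le_add ?_ ?_⟩
  · exact Finset.sum_nonneg fun r _ => C.ind_nonneg _ _
  · exact Finset.sum_nonneg fun r _ => C.ind_nonneg _ _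
  · exact (Finset.sum_le_sum fun r _ => C.ind_le_one l (X r)).trans (by simp)
  · exact (Finset.sum_le_sum fun r _ => C.ind_le_one l (X' r)).trans (by simp)

theorem outProb_mem {p : Fin m → ℝ} (hp : p ∈ stdSimplex ℝ (Fin m)) (l : Fin n) :
    0 ≤ C.outProb p l ∧ C.outProb p l ≤ 1 := by
  have h0 : ∀ ι : Fin T → Fin m, 0 ≤ ∏ t, p (ι t) := fun ι => Finset.prod_nonneg fun t _ => hp.1 _
  refine ⟨Finset.sum_nonneg fun ι _ => mul_nonneg (h0 ι) (C.ind_nonneg _ _), ?_⟩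
  rw [← sum_prod_eq_one (M := T) hp.2]
  exact Finset.sum_le_sum fun ι _ => mul_le_of_le_one_right (h0 ι) (C.ind_le_one _ _)

/-! ### Measurability and uniform bounds -/

theorem measurable_score (i : Fin m) {L : ℕ} (ι : Fin L → Fin m) :
    Measurable (fun p => score C.z p i (fun t => C.z (ι t))) := by
  simp_rw [score_comp C.z_injective]
  fun_prop

theorem continuousOn_score {ε : ℝ} (hε : 0 < ε) (i : Fin m) {L : ℕ} (ι : Fin L → Fin m) :
    ContinuousOn (fun p => score C.z p i (fun t => C.z (ι t))) (restrictedSimplex m ε) := by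
  simp_rw [score_comp C.z_injective]
  refine ContinuousOn.sub ?_ continuousOn_const
  exact continuousOn_finsetSum _ fun t _ =>
    ContinuousOn.div continuousOn_const (by fun_prop) fun p hp => (pos_of_mem hε hp i).ne'

theorem measurable_psiHat (x : Fin M₃ → Fin S → Fin m) (i : Fin m) :
    Measurable (fun p => C.psiHat p (C.points x) i) := by
  unfold psiHat
  refine Measurable.const_mul (Finset.measurable_fun_sum _ fun r _ => ?_) _
  exact (C.measurable_score i (x r)).const_mul _

theorem continuousOn_psiHat {ε : ℝ} (hε : 0 < ε) (x : Fin M₃ → Fin S → Fin m) (i : Fin m) :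
    ContinuousOn (fun p => C.psiHat p (C.points x) i) (restrictedSimplex m ε) := by
  unfold psiHat
  refine continuousOn_const.mul (continuousOn_finsetSum _ fun r _ => ?_)
  exact continuousOn_const.mul (C.continuousOn_score hε i (x r))

theorem measurable_phiPHat (x : Fin M₁ → Fin T → Fin m) (x' : Fin M₂ → Fin T → Fin m)
    (i : Fin m) :
    Measurable (fun v : (Fin m → ℝ) × (Fin n → ℝ) =>
      C.phiPHat v.1 v.2 (C.points x) (C.points x') i) := by
  unfold phiPHat
  refine Measurable.const_mul (Finset.measurable_fun_sum _ fun l _ => ?_) _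
  refine Measurable.mul (by fun_prop) (Measurable.const_mul
    (Finset.measurable_fun_sum _ fun r _ => ?_) _)
  exact ((C.measurable_score i (x' r)).comp measurable_fst).const_mul _

theorem continuousOn_phiPHat {ε : ℝ} (hε : 0 < ε) (x : Fin M₁ → Fin T → Fin m)
    (x' : Fin M₂ → Fin T → Fin m) (i : Fin m) :
    ContinuousOn (fun v : (Fin m → ℝ) × (Fin n → ℝ) =>
      C.phiPHat v.1 v.2 (C.points x) (C.points x') i)
      (restrictedSimplex m ε ×ˢ Set.Icc C.lo C.hi) := by
  unfold phiPHat
  refine continuousOn_const.mul (continuousOn_finsetSum _ fun l _ => ?_)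
  refine ContinuousOn.mul (by fun_prop) (continuousOn_const.mul
    (continuousOn_finsetSum _ fun r _ => ?_))
  exact continuousOn_const.mul ((C.continuousOn_score hε i (x' r)).comp continuousOn_fst
    fun v hv => hv.1)

theorem exists_uniform_bound {J E : Type*} [Finite J] [TopologicalSpace E] {A : Set E}
    (hA : IsCompact A) {f : J → E → ℝ} (hf : ∀ j, ContinuousOn (f j) A) :
    ∃ K, ∀ j, ∀ x ∈ A, |f j x| ≤ K := by
  choose K hK using fun j => hA.exists_bound_of_continuousOn (hf j)
  obtain ⟨B, hB⟩ := (Set.finite_range K).bddAbove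
  exact ⟨B, fun j x hx => (hK j x hx).trans (hB ⟨j, rfl⟩)⟩

/-- Uniform bounds on the estimators and on the derivatives of the output probabilities. -/
theorem exists_estimator_bound {ε : ℝ} (hε : 0 < ε) (M₁ M₂ M₃ : ℕ) :
    ∃ K : ℝ, 0 ≤ K ∧ ∀ p ∈ restrictedSimplex m ε, ∀ s ∈ Set.Icc C.lo C.hi, ∀ i : Fin m,
      (∀ x : Fin M₃ → Fin S → Fin m, |C.psiHat p (C.points x) i| ≤ K) ∧
      (∀ (x : Fin M₁ → Fin T → Fin m) (x' : Fin M₂ → Fin T → Fin m),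
        |C.phiPHat p s (C.points x) (C.points x') i| ≤ K) ∧
      ∀ l, |C.outGrad p l i| ≤ K := by
  obtain ⟨K₁, h₁⟩ := exists_uniform_bound (isCompact_restrictedSimplex m ε)
    (J := (Fin M₃ → Fin S → Fin m) × Fin m) fun j => C.continuousOn_psiHat hε j.1 j.2
  obtain ⟨K₂, h₂⟩ := exists_uniform_bound
    ((isCompact_restrictedSimplex m ε).prod (isCompact_Icc (a := C.lo) (b := C.hi)))
    (J := (Fin M₁ → Fin T → Fin m) × (Fin M₂ → Fin T → Fin m) × Fin m)
    fun j => C.continuousOn_phiPHat hε j.1 j.2.1 j.2.2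
  obtain ⟨K₃, h₃⟩ := exists_uniform_bound (isCompact_restrictedSimplex m ε)
    (J := Fin n × Fin m) fun j => C.continuousOn_outGrad hε j.1 j.2
  refine ⟨max 0 (max K₁ (max K₂ K₃)), le_max_left _ _, fun p hp s hs i => ⟨fun x => ?_,
    fun x x' => ?_, fun l => ?_⟩⟩
  · exact (h₁ (x, i) p hp).trans (by simp)
  · exact (h₂ (x, x', i) (p, s) ⟨hp, hs⟩).trans (by simp)
  · exact (h₃ (l, i) p hp).trans (by simp)

theorem exists_lipschitz_outProb (ε : ℝ) :
    ∃ L : ℝ, 0 ≤ L ∧ ∀ l, ∀ p ∈ restrictedSimplex m ε, ∀ p' ∈ restrictedSimplex m ε,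
      |C.outProb p l - C.outProb p' l| ≤ L * ‖p - p'‖ := by
  have h : ∀ l, ∃ K, LipschitzOnWith K (fun p => C.outProb p l) (restrictedSimplex m ε) := by
    intro l
    exact ((contDiff_inputExp C.z T
      (C.ind l)).locallyLipschitz.locallyLipschitzOn).exists_lipschitzOnWith_of_compact
      (isCompact_restrictedSimplex m ε)
  choose K hK using h
  obtain ⟨B, hB⟩ := (Set.finite_range K).bddAbove
  refine ⟨B, B.2, fun l p hp p' hp' => ?_⟩
  have h1 := (hK l).dist_le_mul p hp p' hp'
  rw [Real.dist_eq, dist_eq_norm] at h1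
  exact h1.trans (mul_le_mul_of_nonneg_right (by exact_mod_cast hB ⟨l, rfl⟩) (norm_nonneg _))

end Problem

/-! ### One-step estimates along a run -/

namespace IsRun

variable {𝒳 : Type*} [MeasurableSpace 𝒳] {m n T S : ℕ} {C : Problem 𝒳 m n T S} {ε : ℝ}
  {γ β lam : ℕ → ℝ} {M₁ M₂ M₃ : ℕ} {Ω : Type*} {mΩ : MeasurableSpace Ω} {μ : Measure Ω}
  {ℱ : Filtration ℕ mΩ} {X : ℕ → Ω → Fin M₁ → Fin T → 𝒳} {X' : ℕ → Ω → Fin M₂ → Fin T → 𝒳}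
  {X'' : ℕ → Ω → Fin M₃ → Fin S → 𝒳} {p : ℕ → Ω → Fin m → ℝ} {s : ℕ → Ω → Fin n → ℝ}

/-- That the intervals are nonempty is forced by the initial slack variables lying in them. -/
theorem lo_le_hi [Nonempty Ω] (hrun : IsRun C ε γ β lam μ ℱ X X' X'' p s) (l : Fin n) :
    C.lo l ≤ C.hi l :=
  (hrun.init_s (Classical.arbitrary Ω) l).1.trans (hrun.init_s (Classical.arbitrary Ω) l).2

theorem mem_restrictedSimplex (hrun : IsRun C ε γ β lam μ ℱ X X' X'' p s) (hε : 0 < ε)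
    (hεm : ε < 1 / m) {k : ℕ} (hk : 1 ≤ k) (ω : Ω) : p k ω ∈ restrictedSimplex m ε := by
  induction k, hk using Nat.le_induction with
  | base => exact hrun.init_p ω
  | succ k hk ih => exact (hrun.step_p k hk ω).mem_restrictedSimplex hε hεm (pos_of_mem hε ih)

theorem slack_mem (hrun : IsRun C ε γ β lam μ ℱ X X' X'' p s) {k : ℕ} (hk : 1 ≤ k) (ω : Ω) :
    s k ω ∈ Set.Icc C.lo C.hi := by
  have : Nonempty Ω := ⟨ω⟩
  induction k, hk using Nat.le_induction with
  | base => exact ⟨fun l => (hrun.init_s ω l).1, fun l => (hrun.init_s ω l).2⟩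
  | succ k hk ih =>
    constructor <;> intro l <;> rw [hrun.step_s k hk ω l]
    · exact (C.proj_mem (hrun.lo_le_hi l) _).1
    · exact (C.proj_mem (hrun.lo_le_hi l) _).2

/-- The event that the simulations of iteration `k` have outcome `j`. -/
def cell (C : Problem 𝒳 m n T S) (X : ℕ → Ω → Fin M₁ → Fin T → 𝒳)
    (X' : ℕ → Ω → Fin M₂ → Fin T → 𝒳) (X'' : ℕ → Ω → Fin M₃ → Fin S → 𝒳) (k : ℕ)
    (j : BatchIndex m T S M₁ M₂ M₃) : Set Ω :=
  {ω | X k ω = C.points j.1 ∧ X' k ω = C.points j.2.1 ∧ X'' k ω = C.points j.2.2}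

theorem measurableSet_cell [MeasurableSingletonClass 𝒳]
    (hrun : IsRun C ε γ β lam μ ℱ X X' X'' p s) {k : ℕ} (hk : 1 ≤ k)
    (j : BatchIndex m T S M₁ M₂ M₃) : MeasurableSet (cell C X X' X'' k j) :=
  (hrun.measurable_X k hk (measurableSet_singleton (C.points j.1))).inter
    ((hrun.measurable_X' k hk (measurableSet_singleton (C.points j.2.1))).inter
      (hrun.measurable_X'' k hk (measurableSet_singleton (C.points j.2.2))))

theorem disjoint_cell (k : ℕ) :
    Pairwise (Function.onFun Disjoint (cell C X X' X'' k)) := by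
  intro i j hij
  refine Set.disjoint_left.2 fun ω hi hj => hij ?_
  obtain ⟨a, b, c⟩ := i
  obtain ⟨a', b', c'⟩ := j
  have h1 := C.points_injective (hi.1.symm.trans hj.1)
  have h2 := C.points_injective (hi.2.1.symm.trans hj.2.1)
  have h3 := C.points_injective (hi.2.2.symm.trans hj.2.2)
  simp only at h1 h2 h3
  rw [h1, h2, h3]

theorem ae_exists_mem_cell [MeasurableSingletonClass 𝒳] [IsProbabilityMeasure μ]
    (hrun : IsRun C ε γ β lam μ ℱ X X' X'' p s) (hε : 0 < ε) (hεm : ε < 1 / m)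
    {k : ℕ} (hk : 1 ≤ k) : ∀ᵐ ω ∂μ, ∃ j, ω ∈ cell C X X' X'' k j :=
  ae_exists_mem_of_condExp (ℱ.le k) (hrun.measurableSet_cell hk) (disjoint_cell k)
    (fun j => hrun.sampling k hk j.1 j.2.1 j.2.2)
    fun ω => BatchIndex.sum_weight (hrun.mem_restrictedSimplex hε hεm hk ω).1.2

theorem integrable_and_condExp [MeasurableSingletonClass 𝒳] [IsProbabilityMeasure μ]
    (hrun : IsRun C ε γ β lam μ ℱ X X' X'' p s) (hε : 0 < ε) (hεm : ε < 1 / m)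
    {k : ℕ} (hk : 1 ≤ k) {f : BatchIndex m T S M₁ M₂ M₃ → Ω → ℝ}
    (hf : ∀ j, Measurable[ℱ k] (f j)) {K : ℝ} (hK : ∀ j ω, |f j ω| ≤ K) {Y : Ω → ℝ}
    (hY : ∀ j, ∀ ω ∈ cell C X X' X'' k j, Y ω = f j ω) :
    Integrable Y μ ∧ μ[Y | ℱ k] =ᵐ[μ] fun ω => ∑ j, j.weight (p k ω) * f j ω :=
  integrable_and_condExp_of_partition (ℱ.le k) (hrun.measurableSet_cell hk) (disjoint_cell k)
    (fun j => hrun.sampling k hk j.1 j.2.1 j.2.2)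
    (fun ω => BatchIndex.sum_weight (hrun.mem_restrictedSimplex hε hεm hk ω).1.2)
    (fun j => (hf j).stronglyMeasurable) hK hY

/-- The tracking error of the `l`-th slack variable. -/
def slackError (C : Problem 𝒳 m n T S) (p : ℕ → Ω → Fin m → ℝ) (s : ℕ → Ω → Fin n → ℝ)
    (l : Fin n) (k : ℕ) (ω : Ω) : ℝ :=
  s k ω l - C.proj l (C.outProb (p k ω) l)

theorem measurable_slackError [Nonempty Ω] (hrun : IsRun C ε γ β lam μ ℱ X X' X'' p s)
    (l : Fin n) {k : ℕ} (hk : 1 ≤ k) : Measurable[ℱ k] (slackError C p s l k) := by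
  have h1 : Measurable[ℱ k] fun ω => C.outProb (p k ω) l :=
    (C.continuous_outProb l).measurable.comp (hrun.measurable_p k hk)
  exact ((measurable_pi_apply l).comp (hrun.measurable_s k hk)).sub
    ((C.continuous_proj (hrun.lo_le_hi l)).measurable.comp h1)

theorem abs_slackError_le [Nonempty Ω] (hrun : IsRun C ε γ β lam μ ℱ X X' X'' p s)
    (l : Fin n) {k : ℕ} (hk : 1 ≤ k) (ω : Ω) :
    |slackError C p s l k ω| ≤ C.hi l - C.lo l := by
  have h1 := hrun.slack_mem hk ω
  have h2 := C.proj_mem (hrun.lo_le_hi l) (C.outProb (p k ω) l)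
  have h3 := h1.1 l
  have h4 := h1.2 l
  rw [slackError, abs_le]
  constructor <;> linarith

theorem integrable_sq_slackError [IsProbabilityMeasure μ]
    (hrun : IsRun C ε γ β lam μ ℱ X X' X'' p s) (l : Fin n) {k : ℕ} (hk : 1 ≤ k) :
    Integrable (fun ω => slackError C p s l k ω ^ 2) μ := by
  have : Nonempty Ω := nonempty_of_isProbabilityMeasure μ
  refine Integrable.of_bound
    (((hrun.measurable_slackError l hk).mono (ℱ.le k) le_rfl).pow_const 2).aestronglyMeasurable
    ((C.hi l - C.lo l) ^ 2) (ae_of_all _ fun ω => ?_)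
  rw [Real.norm_eq_abs, abs_pow]
  exact pow_le_pow_left₀ (abs_nonneg _) (hrun.abs_slackError_le l hk ω) 2

theorem integrable_abs_slackError [IsProbabilityMeasure μ]
    (hrun : IsRun C ε γ β lam μ ℱ X X' X'' p s) (l : Fin n) {k : ℕ} (hk : 1 ≤ k) :
    Integrable (fun ω => |slackError C p s l k ω|) μ := by
  have : Nonempty Ω := nonempty_of_isProbabilityMeasure μ
  refine (Integrable.of_bound
    ((hrun.measurable_slackError l hk).mono (ℱ.le k) le_rfl).aestronglyMeasurable
    (C.hi l - C.lo l) (ae_of_all _ fun ω => ?_)).abs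
  exact hrun.abs_slackError_le l hk ω

/-- On each outcome of the simulations, the step of `p` is of the order of the step size. -/
theorem exists_step_bound (hε : 0 < ε) (hεm : ε < 1 / m) {Λ : ℝ} (hΛ0 : 0 ≤ Λ)
    (hrun : IsRun C ε γ β lam μ ℱ X X' X'' p s) (hΛ : ∀ k, 1 ≤ k → |lam k| ≤ Λ)
    (hγ0 : ∀ k, 1 ≤ k → 0 ≤ γ k) :
    ∃ K : ℝ, 0 ≤ K ∧ (∀ k, 1 ≤ k → ∀ ω j, ω ∈ cell C X X' X'' k j →
      (∀ i, |lam k * C.psiHat (p k ω) (X'' k ω) i +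
        C.phiPHat (p k ω) (s k ω) (X k ω) (X' k ω) i| ≤ K) ∧
      ‖p k ω - p (k + 1) ω‖ ≤ γ k * K) ∧
      (∀ k, 1 ≤ k → ∀ ω i, (∀ j : BatchIndex m T S M₁ M₂ M₃,
        |lam k * C.psiHat (p k ω) (C.points j.2.2) i +
          C.phiPHat (p k ω) (s k ω) (C.points j.1) (C.points j.2.1) i| ≤ K) ∧
        ∀ l, |C.outGrad (p k ω) l i| ≤ K) := by
  obtain ⟨K, hK0, hK⟩ := C.exists_estimator_bound hε M₁ M₂ M₃
  have hm : (1 : ℝ) ≤ m := by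
    have : 0 < m := by
      rcases Nat.eq_zero_or_pos m with h | h
      · subst h; simp at hεm; linarith
      · exact h
    exact_mod_cast this
  have hKm : (Λ + 1) * K ≤ m * ((Λ + 1) * K) := le_mul_of_one_le_left (by positivity) hm
  have hgrad : ∀ k, 1 ≤ k → ∀ ω i, ∀ j : BatchIndex m T S M₁ M₂ M₃,
      |lam k * C.psiHat (p k ω) (C.points j.2.2) i +
        C.phiPHat (p k ω) (s k ω) (C.points j.1) (C.points j.2.1) i| ≤ (Λ + 1) * K := by
    intro k hk ω i j
    obtain ⟨h1, h2, -⟩ := hK _ (hrun.mem_restrictedSimplex hε hεm hk ω) _ (hrun.slack_mem hk ω) i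
    refine (abs_add_le _ _).trans ?_
    rw [abs_mul, add_mul, one_mul]
    exact add_le_add (mul_le_mul (hΛ k hk) (h1 _) (abs_nonneg _) hΛ0) (h2 _ _)
  have hgrad' : ∀ k, 1 ≤ k → ∀ ω j, ω ∈ cell C X X' X'' k j → ∀ i,
      |lam k * C.psiHat (p k ω) (X'' k ω) i +
        C.phiPHat (p k ω) (s k ω) (X k ω) (X' k ω) i| ≤ (Λ + 1) * K := by
    intro k hk ω j hj i
    rw [hj.1, hj.2.1, hj.2.2]
    exact hgrad k hk ω i j
  -- `(Λ + 1) * K` bounds each coordinate of the gradient estimate. The factor `m` also covers the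
  -- root of a sum of `m` squares, as `m ≤ m ^ 2`.
  refine ⟨m * ((Λ + 1) * K), by positivity, fun k hk ω j hj => ⟨fun i =>
    (hgrad' k hk ω j hj i).trans hKm, ?_⟩, fun k hk ω i => ⟨fun j =>
    (hgrad k hk ω i j).trans hKm, fun l => ?_⟩⟩
  · have h1 := (hrun.step_p k hk ω).step_le hε hεm (hrun.mem_restrictedSimplex hε hεm hk ω)
    have h2 : ∑ i, (γ k * (lam k * C.psiHat (p k ω) (X'' k ω) i +
        C.phiPHat (p k ω) (s k ω) (X k ω) (X' k ω) i)) ^ 2 ≤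
        ∑ _i : Fin m, (γ k * ((Λ + 1) * K)) ^ 2 := by
      refine Finset.sum_le_sum fun i _ => ?_
      rw [mul_pow, mul_pow]
      exact mul_le_mul_of_nonneg_left (sq_le_sq' (abs_le.1 (hgrad' k hk ω j hj i)).1
        (abs_le.1 (hgrad' k hk ω j hj i)).2) (sq_nonneg _)
    have h3 : ∑ _i : Fin m, (γ k * ((Λ + 1) * K)) ^ 2 ≤ (γ k * (m * ((Λ + 1) * K))) ^ 2 := by
      rw [Finset.sum_const, Finset.card_univ, Fintype.card_fin, nsmul_eq_mul]
      have : (γ k * (m * ((Λ + 1) * K))) ^ 2 = m * (m * (γ k * ((Λ + 1) * K)) ^ 2) := by ring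
      rw [this]
      exact mul_le_mul_of_nonneg_left (le_mul_of_one_le_left (sq_nonneg _) hm) (by positivity)
    have hγk := hγ0 k hk
    refine (pi_norm_le_iff_of_nonneg (by positivity)).2 fun i => ?_
    refine abs_le_of_sq_le_sq ?_ (by positivity)
    refine le_trans ?_ (h1.trans (h2.trans h3))
    exact Finset.single_le_sum (f := fun i => (p k ω i - p (k + 1) ω i) ^ 2)
      (fun i _ => sq_nonneg _) (Finset.mem_univ i)
  · have h1 := (hK _ (hrun.mem_restrictedSimplex hε hεm hk ω) _ (hrun.slack_mem hk ω) i).2.2 l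
    refine h1.trans (le_trans ?_ hKm)
    exact le_mul_of_one_le_left hK0 (by linarith)

/-- The elementary inequality behind the contraction of the tracking error. -/
theorem sq_add_le_of_abs_le {D N x y t R B b : ℝ} (ht : 0 < t) (htb : t ≤ b) (hD : |D| ≤ R)
    (hN : |N| ≤ 1) (hx : |x| ≤ |(1 - 2 * t) * D + 2 * t * N|) (hy : |y| ≤ B) :
    (x + y) ^ 2 ≤ D ^ 2 - 2 * t * D ^ 2 + (1 + 2 * t) * (4 * t * (1 - 2 * t)) * (D * N) +
      ((8 * b * R ^ 2 + 4 * (1 + 2 * b)) * t ^ 2 + (b + 1 / 2) * (B ^ 2 / t)) := by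
  have hD2 : D ^ 2 ≤ R ^ 2 := sq_le_sq' (abs_le.1 hD).1 (abs_le.1 hD).2
  have hN2 : N ^ 2 ≤ 1 := by simpa using sq_le_sq' (abs_le.1 hN).1 (abs_le.1 hN).2
  have hy2 : y ^ 2 ≤ B ^ 2 := sq_le_sq' (abs_le.1 hy).1 (abs_le.1 hy).2
  have hx2 : x ^ 2 ≤ ((1 - 2 * t) * D + 2 * t * N) ^ 2 := sq_le_sq.2 hx
  -- Young's inequality with weight `2 * t`: of the contraction `4 * t` contained in `(1 - 2 * t) ^
  -- 2`, half is spent on the cross term with `y`.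
  have h1 : (x + y) ^ 2 ≤ (1 + 2 * t) * x ^ 2 + (t + 1 / 2) * (y ^ 2 / t) := by
    have h2 : (1 + 2 * t) * x ^ 2 + (t + 1 / 2) * (y ^ 2 / t) - (x + y) ^ 2 =
        (2 * t * x - y) ^ 2 / (2 * t) := by field_simp; ring
    have h3 : 0 ≤ (2 * t * x - y) ^ 2 / (2 * t) := by positivity
    linarith
  have h4 : (t + 1 / 2) * (y ^ 2 / t) ≤ (b + 1 / 2) * (B ^ 2 / t) :=
    mul_le_mul (by linarith) (div_le_div_of_nonneg_right hy2 ht.le) (by positivity) (by linarith)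
  have h5 : (1 + 2 * t) * x ^ 2 ≤ (1 + 2 * t) * ((1 - 2 * t) * D + 2 * t * N) ^ 2 :=
    mul_le_mul_of_nonneg_left hx2 (by linarith)
  have h6 : (1 + 2 * t) * ((1 - 2 * t) * D + 2 * t * N) ^ 2 =
      D ^ 2 - 2 * t * D ^ 2 + (1 + 2 * t) * (4 * t * (1 - 2 * t)) * (D * N) +
      (8 * t * D ^ 2 + 4 * (1 + 2 * t) * N ^ 2 - 4 * D ^ 2) * t ^ 2 := by ring
  have h7 : (8 * t * D ^ 2 + 4 * (1 + 2 * t) * N ^ 2 - 4 * D ^ 2) * t ^ 2 ≤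
      (8 * b * R ^ 2 + 4 * (1 + 2 * b)) * t ^ 2 := by
    refine mul_le_mul_of_nonneg_right ?_ (sq_nonneg t)
    have h8 : t * D ^ 2 ≤ b * R ^ 2 := mul_le_mul htb hD2 (sq_nonneg _) (by linarith)
    have h9 : (1 + 2 * t) * N ^ 2 ≤ (1 + 2 * b) * 1 :=
      mul_le_mul (by linarith) hN2 (sq_nonneg _) (by linarith)
    nlinarith [sq_nonneg D]
  linarith

/-- The mean square tracking errors contract up to terms of the order of the squared step of the
slack variables and the squared ratio of the steps. -/
theorem exists_integral_sq_slackError_le [MeasurableSingletonClass 𝒳] [IsProbabilityMeasure μ]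
    (hrun : IsRun C ε γ β lam μ ℱ X X' X'' p s)
    (hε : 0 < ε) (hεm : ε < 1 / m) (hM₁ : 0 < M₁) {Λ b : ℝ} (hΛ0 : 0 ≤ Λ)
    (hΛ : ∀ k, 1 ≤ k → |lam k| ≤ Λ) (hγ0 : ∀ k, 1 ≤ k → 0 ≤ γ k)
    (hβ : ∀ k, 1 ≤ k → 0 < β k ∧ β k ≤ b) (l : Fin n) :
    ∃ K : ℝ, 0 ≤ K ∧ ∀ k, 1 ≤ k → ∫ ω, slackError C p s l (k + 1) ω ^ 2 ∂μ ≤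
      ∫ ω, slackError C p s l k ω ^ 2 ∂μ - 2 * β k * ∫ ω, slackError C p s l k ω ^ 2 ∂μ +
        K * (β k ^ 2 + γ k ^ 2 / β k) := by
  have : Nonempty Ω := nonempty_of_isProbabilityMeasure μ
  obtain ⟨K, hK0, hK, -⟩ := hrun.exists_step_bound hε hεm hΛ0 hΛ hγ0
  obtain ⟨L, hL0, hL⟩ := C.exists_lipschitz_outProb ε
  have hb0 : 0 ≤ b := ((hβ 1 le_rfl).1.le).trans (hβ 1 le_rfl).2
  set R := C.hi l - C.lo l with hR
  set K₁ := 8 * b * R ^ 2 + 4 * (1 + 2 * b) with hK₁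
  set K₂ := (b + 1 / 2) * (L * K) ^ 2 with hK₂
  have hK₁0 : 0 ≤ K₁ := by positivity
  have hK₂0 : 0 ≤ K₂ := by positivity
  refine ⟨K₁ + K₂, by positivity, fun k hk => ?_⟩
  obtain ⟨hβ0, hβb⟩ := hβ k hk
  set D := slackError C p s l k with hD
  set N : Ω → ℝ := fun ω => C.outHat (X k ω) (X' k ω) l - C.outProb (p k ω) l with hN
  have hDle : ∀ ω, |D ω| ≤ R := hrun.abs_slackError_le l hk
  have hN1 : ∀ (x : Fin M₁ → Fin T → 𝒳) (x' : Fin M₂ → Fin T → 𝒳) ω,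
      |C.outHat x x' l - C.outProb (p k ω) l| ≤ 1 := by
    intro x x' ω
    have h1 := C.outHat_mem hM₁ x x' l
    have h2 := C.outProb_mem (hrun.mem_restrictedSimplex hε hεm hk ω).1 l
    rw [abs_le]; constructor <;> linarith
  have hDm : Measurable[ℱ k] D := hrun.measurable_slackError l hk
  have hsqi : ∀ k, 1 ≤ k → Integrable (fun ω => slackError C p s l k ω ^ 2) μ := fun k hk =>
    hrun.integrable_sq_slackError l hk
  have hDN := hrun.integrable_and_condExp hε hεm hk (Y := fun ω => D ω * N ω) (K := R * 1)
    (f := fun j ω => D ω * (C.outHat (C.points j.1) (C.points j.2.1) l - C.outProb (p k ω) l))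
    (fun j => hDm.mul (measurable_const.sub
      ((C.continuous_outProb l).measurable.comp (hrun.measurable_p k hk))))
    (fun j ω => by
      rw [abs_mul]
      exact mul_le_mul (hDle ω) (hN1 _ _ ω) (abs_nonneg _) ((abs_nonneg _).trans (hDle ω)))
    (fun j ω hj => by simp only [hN]; rw [hj.1, hj.2.1])
  -- `D` is known before the simulations and the noise `N` is conditionally centred.
  have hDN0 : ∫ ω, D ω * N ω ∂μ = 0 := by
    rw [← integral_condExp (ℱ.le k), integral_congr_ae hDN.2]
    have : ∀ ω, ∑ j : BatchIndex m T S M₁ M₂ M₃, j.weight (p k ω) *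
        (D ω * (C.outHat (C.points j.1) (C.points j.2.1) l - C.outProb (p k ω) l)) = 0 := by
      intro ω
      have hp := (hrun.mem_restrictedSimplex hε hεm hk ω).1.2
      have h1 : ∀ j : BatchIndex m T S M₁ M₂ M₃, j.weight (p k ω) *
          (D ω * (C.outHat (C.points j.1) (C.points j.2.1) l - C.outProb (p k ω) l)) =
          D ω * (j.weight (p k ω) * C.outHat (C.points j.1) (C.points j.2.1) l) -
          D ω * C.outProb (p k ω) l * j.weight (p k ω) := fun j => by ring
      simp_rw [h1, Finset.sum_sub_distrib, ← Finset.mul_sum, C.sum_weight_mul_outHat hM₁ hp,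
        BatchIndex.sum_weight hp]
      ring
    simp_rw [this, integral_zero]
  have hpt : ∀ᵐ ω ∂μ, slackError C p s l (k + 1) ω ^ 2 ≤ D ω ^ 2 - 2 * β k * D ω ^ 2 +
      (1 + 2 * β k) * (4 * β k * (1 - 2 * β k)) * (D ω * N ω) +
      (K₁ * β k ^ 2 + (b + 1 / 2) * ((L * (γ k * K)) ^ 2 / β k)) := by
    filter_upwards [hrun.ae_exists_mem_cell hε hεm hk] with ω ⟨j, hj⟩
    set τ := C.proj l (C.outProb (p k ω) l) with hτ
    have h1 : slackError C p s l (k + 1) ω = (s (k + 1) ω l - τ) +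
        (τ - C.proj l (C.outProb (p (k + 1) ω) l)) := by rw [slackError]; ring
    rw [h1]
    refine sq_add_le_of_abs_le hβ0 hβb (hDle ω) (hN1 (X k ω) (X' k ω) ω) ?_ ?_
    · rw [hrun.step_s k hk ω l, C.phiSHat_eq hM₁]
      -- The target `τ` is a fixed point of the noiseless update, so nonexpansiveness of the
      -- projection compares two updates, whose arguments differ by `(1 - 2β) D + 2β N`.
      have h2 := C.proj_add_mul (hrun.lo_le_hi l) (C.outProb (p k ω) l)
        (t := 2 * β k) (by linarith)
      rw [← hτ] at h2
      nth_rewrite 1 [← h2]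
      refine (C.abs_proj_sub_proj_le (hrun.lo_le_hi l) _ _).trans (le_of_eq ?_)
      congr 1
      simp only [hD, slackError, ← hτ]
      ring
    · refine (C.abs_proj_sub_proj_le (hrun.lo_le_hi l) _ _).trans ?_
      refine (hL l _ (hrun.mem_restrictedSimplex hε hεm hk ω) _
        (hrun.mem_restrictedSimplex hε hεm (by omega) ω)).trans ?_
      exact mul_le_mul_of_nonneg_left (hK k hk ω j hj).2 hL0
  have hi1 : Integrable (fun ω => D ω ^ 2) μ := hsqi k hk
  have hi2 : Integrable (fun ω => D ω ^ 2 - 2 * β k * D ω ^ 2) μ := hi1.sub (hi1.const_mul _)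
  have hi3 : Integrable (fun ω => (1 + 2 * β k) * (4 * β k * (1 - 2 * β k)) * (D ω * N ω)) μ :=
    hDN.1.const_mul _
  have hi4 := hi2.add hi3
  simp only [Pi.add_def] at hi4
  calc ∫ ω, slackError C p s l (k + 1) ω ^ 2 ∂μ
      ≤ ∫ ω, (D ω ^ 2 - 2 * β k * D ω ^ 2 +
      (1 + 2 * β k) * (4 * β k * (1 - 2 * β k)) * (D ω * N ω) +
      (K₁ * β k ^ 2 + (b + 1 / 2) * ((L * (γ k * K)) ^ 2 / β k))) ∂μ :=
        integral_mono_ae (hsqi (k + 1) (by omega))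
          (hi4.add (integrable_const _)) hpt
    _ = ∫ ω, D ω ^ 2 ∂μ - 2 * β k * ∫ ω, D ω ^ 2 ∂μ +
        (K₁ * β k ^ 2 + K₂ * (γ k ^ 2 / β k)) := by
        rw [integral_add hi4 (integrable_const _), integral_add hi2 hi3,
          integral_sub hi1 (hi1.const_mul _), integral_const_mul, integral_const_mul, hDN0]
        simp only [integral_const, probReal_univ, one_smul, mul_zero, add_zero, hK₂]
        ring
    _ ≤ _ := by
        have h1 : 0 ≤ K₂ * β k ^ 2 := by positivity
        have h2 : 0 ≤ K₁ * (γ k ^ 2 / β k) := by positivity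
        linarith

set_option maxHeartbeats 1000000 in
/-- One-step inequality for the divergence from the points of a curve in the simplex. -/
theorem exists_condExp_kl_le [MeasurableSingletonClass 𝒳] [IsProbabilityMeasure μ]
    (hrun : IsRun C ε γ β lam μ ℱ X X' X'' p s)
    (hε : 0 < ε) (hεm : ε < 1 / m) (hM₁ : 0 < M₁) (hM₂ : 0 < M₂) (hM₃ : 0 < M₃)
    {Λ : ℝ} (hΛ0 : 0 ≤ Λ) (hΛ : ∀ k, 1 ≤ k → |lam k| ≤ Λ) (hγ0 : ∀ k, 1 ≤ k → 0 ≤ γ k) :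
    ∃ K : ℝ, 0 ≤ K ∧ ∀ k, 1 ≤ k → ∀ u ∈ restrictedSimplex m ε, ∀ u' ∈ restrictedSimplex m ε,
      μ[fun ω => kl u' (p (k + 1) ω) | ℱ k] ≤ᵐ[μ] fun ω => kl u (p k ω) -
        γ k * ∑ i, (lam k * gateaux C.psi (p k ω) i + gateaux C.penalty (p k ω) i) *
          (p k ω i - u i) +
        K * (γ k * ∑ l, |slackError C p s l k ω| + γ k ^ 2 + ‖u' - u‖) := by
  have : Nonempty Ω := nonempty_of_isProbabilityMeasure μ
  obtain ⟨K, hK0, hK, hK'⟩ := hrun.exists_step_bound hε hεm hΛ0 hΛ hγ0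
  set K₁ := 2 * (m * K) with hK₁
  set K₂ := m * K ^ 2 with hK₂
  set K₃ := max 0 (m * -Real.log ε) with hK₃
  have hK₁0 : 0 ≤ K₁ := by positivity
  have hK₂0 : 0 ≤ K₂ := by positivity
  have hK₃0 : 0 ≤ K₃ := le_max_left _ _
  refine ⟨K₁ + K₂ + K₃, by positivity, fun k hk u hu u' hu' => ?_⟩
  have hps := fun ω => hrun.mem_restrictedSimplex hε hεm hk ω
  have hγk := hγ0 k hk
  have hpu : ∀ ω i, |p k ω i - u i| ≤ 1 := fun ω i => by
    have h1 := le_one_of_mem (hps ω) i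
    have h2 := le_one_of_mem hu i
    have h3 := (pos_of_mem hε (hps ω) i).le
    have h4 := (pos_of_mem hε hu i).le
    rw [abs_le]; constructor <;> linarith
  set c := γ k ^ 2 * K₂ + K₃ * ‖u' - u‖ with hc
  -- `Y` dominates the next divergence almost surely. Unlike that divergence, it is an explicit
  -- function of the past on each cell, so its conditional expectation is a finite sum.
  set Y : Ω → ℝ := fun ω => kl u (p k ω) - γ k * ∑ i,
    (lam k * C.psiHat (p k ω) (X'' k ω) i + C.phiPHat (p k ω) (s k ω) (X k ω) (X' k ω) i) *
      (p k ω i - u i) + c with hYdef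
  set f : BatchIndex m T S M₁ M₂ M₃ → Ω → ℝ := fun j ω => kl u (p k ω) - γ k * ∑ i,
    (lam k * C.psiHat (p k ω) (C.points j.2.2) i +
      C.phiPHat (p k ω) (s k ω) (C.points j.1) (C.points j.2.1) i) * (p k ω i - u i) + c with hf
  have hpm := hrun.measurable_p k hk
  have hsm := hrun.measurable_s k hk
  have hfm : ∀ j, Measurable[ℱ k] (f j) := by
    intro j
    have h1 : Measurable fun v : (Fin m → ℝ) × (Fin n → ℝ) => kl u v.1 - γ k * ∑ i,
        (lam k * C.psiHat v.1 (C.points j.2.2) i +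
        C.phiPHat v.1 v.2 (C.points j.1) (C.points j.2.1) i) * (v.1 i - u i) + c := by
      refine (((measurable_kl u).comp measurable_fst).sub (Measurable.const_mul
        (Finset.measurable_fun_sum _ fun i _ => Measurable.mul (Measurable.add
          (((C.measurable_psiHat j.2.2 i).comp measurable_fst).const_mul _)
          (C.measurable_phiPHat j.1 j.2.1 i)) (by fun_prop)) _)).add_const c
    have h2 : Measurable[ℱ k] fun ω => (p k ω, s k ω) := hpm.prodMk hsm
    have h3 := h1.comp h2
    simp only [Function.comp_def] at h3
    exact h3
  have hfb : ∀ j ω, |f j ω| ≤ -Real.log ε + γ k * ∑ _i : Fin m, K * 1 + |c| := by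
    intro j ω
    refine (abs_add_le _ _).trans (add_le_add ((abs_sub _ _).trans (add_le_add
      (abs_kl_le hε hu (hps ω)) ?_)) le_rfl)
    rw [abs_mul, abs_of_nonneg hγk]
    refine mul_le_mul_of_nonneg_left ((Finset.abs_sum_le_sum_abs _ _).trans
      (Finset.sum_le_sum fun i _ => ?_)) hγk
    rw [abs_mul]
    exact mul_le_mul ((hK' k hk ω i).1 j) (hpu ω i) (abs_nonneg _) hK0
  obtain ⟨hYi, hYc⟩ := hrun.integrable_and_condExp hε hεm hk hfm hfb (Y := Y)
    (fun j ω hj => by simp only [hYdef, hf]; rw [hj.1, hj.2.1, hj.2.2])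
  have hVY : (fun ω => kl u' (p (k + 1) ω)) ≤ᵐ[μ] Y := by
    filter_upwards [hrun.ae_exists_mem_cell hε hεm hk] with ω ⟨j, hj⟩
    have hp1 := hrun.mem_restrictedSimplex hε hεm (k := k + 1) (by omega) ω
    have h1 := (hrun.step_p k hk ω).kl_le hε hεm (hps ω) hu
    have h2 := kl_sub_kl_le_norm hε hu' hu hp1
    have h3 : m * -Real.log ε * ‖u' - u‖ ≤ K₃ * ‖u' - u‖ :=
      mul_le_mul_of_nonneg_right (le_max_right _ _) (norm_nonneg _)
    have h4 : ∑ i, (γ k * (lam k * C.psiHat (p k ω) (X'' k ω) i +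
        C.phiPHat (p k ω) (s k ω) (X k ω) (X' k ω) i)) ^ 2 ≤ γ k ^ 2 * K₂ := by
      calc _ ≤ ∑ _i : Fin m, γ k ^ 2 * K ^ 2 := by
            refine Finset.sum_le_sum fun i _ => ?_
            rw [mul_pow]
            have := abs_le.1 ((hK k hk ω j hj).1 i)
            exact mul_le_mul_of_nonneg_left (sq_le_sq' this.1 this.2) (sq_nonneg _)
        _ = γ k ^ 2 * K₂ := by simp [hK₂]; ring
    have h5 : ∑ i, γ k * (lam k * C.psiHat (p k ω) (X'' k ω) i +
        C.phiPHat (p k ω) (s k ω) (X k ω) (X' k ω) i) * (p k ω i - u i) =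
        γ k * ∑ i, (lam k * C.psiHat (p k ω) (X'' k ω) i +
        C.phiPHat (p k ω) (s k ω) (X k ω) (X' k ω) i) * (p k ω i - u i) := by
      rw [Finset.mul_sum]
      exact Finset.sum_congr rfl fun i _ => by ring
    rw [h5] at h1
    simp only [hYdef, hc]
    linarith
  have hVi : Integrable (fun ω => kl u' (p (k + 1) ω)) μ := by
    refine Integrable.of_bound (C := -Real.log ε)
      (((measurable_kl u').comp (hrun.measurable_p (k + 1) (by omega))).mono (ℱ.le _)
        le_rfl).aestronglyMeasurable (ae_of_all _ fun ω => ?_)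
    exact abs_kl_le hε hu' (hrun.mem_restrictedSimplex hε hεm (by omega) ω)
  filter_upwards [condExp_mono (m := ℱ k) hVi hYi hVY, hYc] with ω h1 h2
  refine h1.trans (h2.le.trans ?_)
  have hpsum := (hps ω).1.2
  have hppos := pos_of_mem hε (hps ω)
  set e : Fin n → ℝ := fun l => slackError C p s l k ω with he
  have hE : ∑ j : BatchIndex m T S M₁ M₂ M₃, j.weight (p k ω) * f j ω =
      kl u (p k ω) - γ k * ∑ i, (lam k * gateaux C.psi (p k ω) i +
        2 * ∑ l, (C.outProb (p k ω) l - s k ω l) * C.outGrad (p k ω) l i) *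
          (p k ω i - u i) + c := by
    have h3 : ∀ j : BatchIndex m T S M₁ M₂ M₃, j.weight (p k ω) * f j ω =
        (kl u (p k ω) + c) * j.weight (p k ω) - γ k * ∑ i,
          (lam k * (j.weight (p k ω) * C.psiHat (p k ω) (C.points j.2.2) i) +
          (j.weight (p k ω) * C.phiPHat (p k ω) (s k ω) (C.points j.1) (C.points j.2.1) i)) *
            (p k ω i - u i) := by
      intro j
      have h4 : ∑ i, (lam k * (j.weight (p k ω) * C.psiHat (p k ω) (C.points j.2.2) i) +
          (j.weight (p k ω) * C.phiPHat (p k ω) (s k ω) (C.points j.1) (C.points j.2.1) i)) *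
            (p k ω i - u i) = j.weight (p k ω) * ∑ i,
          (lam k * C.psiHat (p k ω) (C.points j.2.2) i +
          C.phiPHat (p k ω) (s k ω) (C.points j.1) (C.points j.2.1) i) * (p k ω i - u i) := by
        rw [Finset.mul_sum]
        exact Finset.sum_congr rfl fun i _ => by ring
      rw [h4]; simp only [hf]; ring
    simp_rw [h3, Finset.sum_sub_distrib, ← Finset.mul_sum]
    rw [Finset.sum_comm]
    simp_rw [← Finset.sum_mul, Finset.sum_add_distrib, ← Finset.mul_sum,
      C.sum_weight_mul_psiHat hM₃ hpsum hppos, C.sum_weight_mul_phiPHat hM₁ hM₂ hpsum,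
      BatchIndex.sum_weight hpsum]
    ring
  rw [hE]
  -- The mean direction uses `s` where the true gradient has the projected probability; the
  -- difference is linear in the slack errors `e`.
  have hsplit : ∑ i, (lam k * gateaux C.psi (p k ω) i +
      2 * ∑ l, (C.outProb (p k ω) l - s k ω l) * C.outGrad (p k ω) l i) * (p k ω i - u i) =
      ∑ i, (lam k * gateaux C.psi (p k ω) i + gateaux C.penalty (p k ω) i) * (p k ω i - u i) -
      2 * ∑ i, ∑ l, e l * C.outGrad (p k ω) l i * (p k ω i - u i) := by
    rw [Finset.mul_sum, ← Finset.sum_sub_distrib]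
    refine Finset.sum_congr rfl fun i _ => ?_
    rw [C.gateaux_penalty hrun.lo_le_hi hppos, ← Finset.sum_mul, ← mul_assoc, ← sub_mul]
    congr 1
    rw [add_sub_assoc, ← mul_sub, ← Finset.sum_sub_distrib]
    congr 3
    ext l
    simp only [he, slackError]
    ring
  have hcross : |∑ i, ∑ l, e l * C.outGrad (p k ω) l i * (p k ω i - u i)| ≤
      m * K * ∑ l, |e l| := by
    calc _ ≤ ∑ _i : Fin m, ∑ l, |e l| * K * 1 := by
          refine (Finset.abs_sum_le_sum_abs _ _).trans (Finset.sum_le_sum fun i _ =>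
            (Finset.abs_sum_le_sum_abs _ _).trans (Finset.sum_le_sum fun l _ => ?_))
          rw [abs_mul, abs_mul]
          exact mul_le_mul (mul_le_mul_of_nonneg_left ((hK' k hk ω i).2 l) (abs_nonneg _))
            (hpu ω i) (abs_nonneg _) (by positivity)
      _ = m * K * ∑ l, |e l| := by simp [← Finset.sum_mul]; ring
  rw [hsplit]
  have h5 := mul_le_mul_of_nonneg_left (abs_le.1 hcross).2 hγk
  have h6 : 0 ≤ ∑ l, |e l| := Finset.sum_nonneg fun l _ => abs_nonneg _
  have h7 : 0 ≤ (K₂ + K₃) * (γ k * ∑ l, |e l|) := by positivity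
  have h8 : 0 ≤ (K₁ + K₃) * γ k ^ 2 := by positivity
  have h9 : 0 ≤ (K₁ + K₂) * ‖u' - u‖ := by positivity
  simp only [hc, hK₁] at *
  linarith

end IsRun

/-! ### Step sizes and penalty coefficients -/

section StepSizes

/-- The terms dominate the increments of `log log`, by `log x ≤ x - 1` applied twice. -/
theorem not_summable_inv_mul_log :
    ¬ Summable fun k : ℕ => 1 / (((k : ℝ) + 2) * Real.log ((k : ℝ) + 2)) := by
  intro h
  have hstep : ∀ k : ℕ, Real.log (Real.log ((k : ℝ) + 1 + 2)) - Real.log (Real.log ((k : ℝ) + 2)) ≤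
      1 / (((k : ℝ) + 2) * Real.log ((k : ℝ) + 2)) := by
    intro k
    have hk : (0 : ℝ) ≤ k := by positivity
    have h0 : 0 < Real.log ((k : ℝ) + 2) := Real.log_pos (by linarith)
    have h1 : 0 < Real.log ((k : ℝ) + 1 + 2) := Real.log_pos (by linarith)
    rw [← Real.log_div h1.ne' h0.ne']
    refine (Real.log_le_sub_one_of_pos (div_pos h1 h0)).trans ?_
    have h2 : Real.log ((k : ℝ) + 1 + 2) - Real.log ((k : ℝ) + 2) ≤ 1 / ((k : ℝ) + 2) := by
      rw [← Real.log_div (by linarith) (by linarith)]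
      refine (Real.log_le_sub_one_of_pos (by positivity)).trans (le_of_eq ?_)
      field_simp
      ring
    rw [div_sub_one h0.ne', ← div_div]
    exact div_le_div_of_nonneg_right h2 h0.le
  have hsum : ∀ N : ℕ, Real.log (Real.log ((N : ℝ) + 2)) - Real.log (Real.log 2) ≤
      ∑' k : ℕ, 1 / (((k : ℝ) + 2) * Real.log ((k : ℝ) + 2)) := by
    intro N
    refine le_trans ?_ (h.sum_le_tsum (Finset.range N) fun k _ => ?_)
    · induction N with
      | zero => simp
      | succ N ih =>
        rw [Finset.sum_range_succ]
        push_cast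
        linarith [hstep N]
    · have : 0 < Real.log ((k : ℝ) + 2) := Real.log_pos (by
        have : (0 : ℝ) ≤ k := by positivity
        linarith)
      positivity
  have htend : Tendsto (fun N : ℕ => Real.log (Real.log ((N : ℝ) + 2))) atTop atTop :=
    Real.tendsto_log_atTop.comp (Real.tendsto_log_atTop.comp
      (tendsto_atTop_add_const_right _ _ tendsto_natCast_atTop_atTop))
  obtain ⟨N, hN⟩ := (htend.eventually_gt_atTop
    (∑' k : ℕ, 1 / (((k : ℝ) + 2) * Real.log ((k : ℝ) + 2)) + Real.log (Real.log 2))).exists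
  linarith [hsum N]

/-- Divergence of `∑ γ λ` is what `α₃ ≤ 1 - α₁` and, at `α₁ = 1`, the logarithm provide. Positivity
and monotonicity start at `k = 2` because `lam 1` is arbitrary in the logarithmic case. -/
theorem penalty_coefficient_properties {a c α₁ : ℝ} (ha : 0 < a) (hc : 0 < c) (hα : α₁ ≤ 1)
    {γ lam : ℕ → ℝ} (hγ : ∀ k : ℕ, 1 ≤ k → γ k = a / (k : ℝ) ^ α₁)
    (hlam_lt : α₁ < 1 → ∃ α₃ : ℝ, 0 < α₃ ∧ α₃ ≤ 1 - α₁ ∧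
      ∀ k : ℕ, 1 ≤ k → lam k = c / (k : ℝ) ^ α₃)
    (hlam_one : α₁ = 1 → 0 < lam 1 ∧ ∀ k : ℕ, 2 ≤ k → lam k = c / Real.log k) :
    (∀ k ≥ 2, 0 < lam k) ∧ (∀ k ≥ 2, lam (k + 1) ≤ lam k) ∧ Tendsto lam atTop (𝓝 0) ∧
      ¬ Summable fun k => γ k * lam k := by
  rcases hα.lt_or_eq with h | h
  · obtain ⟨α₃, h0, h1, h2⟩ := hlam_lt h
    refine ⟨fun k hk => ?_, fun k hk => ?_, ?_, fun hs => ?_⟩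
    · rw [h2 k (by omega)]
      have : (0 : ℝ) < k := by exact_mod_cast (by omega : 0 < k)
      positivity
    · have hk0 : (0 : ℝ) < k := by exact_mod_cast (by omega : 0 < k)
      rw [h2 k (by omega), h2 (k + 1) (by omega)]
      refine div_le_div_of_nonneg_left hc.le (by positivity)
        (Real.rpow_le_rpow hk0.le (by push_cast; linarith) h0.le)
    · have h3 : Tendsto (fun k : ℕ => c / (k : ℝ) ^ α₃) atTop (𝓝 0) :=
        Tendsto.const_div_atTop ((tendsto_rpow_atTop h0).comp tendsto_natCast_atTop_atTop) c
      refine h3.congr' ?_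
      filter_upwards [eventually_ge_atTop 1] with k hk
      rw [h2 k hk]
    · have h3 : Summable fun k : ℕ => 1 / (k : ℝ) ^ (α₁ + α₃) := by
        rw [← summable_nat_add_iff 1] at hs ⊢
        refine (hs.mul_left (a * c)⁻¹).congr fun k => ?_
        have hk0 : (0 : ℝ) < ((k + 1 : ℕ) : ℝ) := by positivity
        rw [hγ _ (by omega), h2 _ (by omega), Real.rpow_add hk0]
        field_simp
      rw [Real.summable_one_div_nat_rpow] at h3
      linarith
  · obtain ⟨-, h2⟩ := hlam_one h
    refine ⟨fun k hk => ?_, fun k hk => ?_, ?_, fun hs => ?_⟩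
    · rw [h2 k hk]
      exact div_pos hc (Real.log_pos (by exact_mod_cast hk))
    · rw [h2 k hk, h2 (k + 1) (by omega)]
      have hk1 : (1 : ℝ) < k := by exact_mod_cast hk
      exact div_le_div_of_nonneg_left hc.le (Real.log_pos hk1)
        (Real.log_le_log (by linarith) (by push_cast; linarith))
    · have h3 : Tendsto (fun k : ℕ => c / Real.log k) atTop (𝓝 0) :=
        Tendsto.const_div_atTop (Real.tendsto_log_atTop.comp tendsto_natCast_atTop_atTop) c
      refine h3.congr' ?_
      filter_upwards [eventually_ge_atTop 2] with k hk
      rw [h2 k hk]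
    · refine not_summable_inv_mul_log ?_
      rw [← summable_nat_add_iff 2] at hs
      refine (hs.mul_left (a * c)⁻¹).congr fun k => ?_
      have : 0 < Real.log ((k : ℝ) + 2) := Real.log_pos (by
        have : (0 : ℝ) ≤ k := by positivity
        linarith)
      rw [hγ _ (by omega), h2 _ (by omega), h, Real.rpow_one]
      push_cast
      field_simp

end StepSizes

/-- Gives measurability of the drift along the iterates, its continuity being established only on
the restricted simplex. -/
theorem _root_.ContinuousOn.measurable_comp_of_mem {Ω E : Type*} {m₀ : MeasurableSpace Ω}
    [TopologicalSpace E] [MeasurableSpace E] [OpensMeasurableSpace E] {f : E → ℝ} {A : Set E}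
    (hf : ContinuousOn f A) {x : Ω → E} (hx : Measurable x) (hxA : ∀ ω, x ω ∈ A) :
    Measurable fun ω => f (x ω) := by
  have h1 : Measurable fun ω => (⟨x ω, hxA ω⟩ : A) := hx.subtype_mk
  exact hf.domRestrict.measurable.comp h1

/-! ### Pathwise identification of the limit -/

namespace Problem

variable {𝒳 : Type*} {m n T S : ℕ} (C : Problem 𝒳 m n T S)

/-- The drift of the penalized program at `p` away from `u`. -/
def drift (t : ℝ) (u p : Fin m → ℝ) : ℝ :=
  ∑ i, (t * gateaux C.psi p i + gateaux C.penalty p i) * (p i - u i)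

theorem continuousOn_drift (h : ∀ l, C.lo l ≤ C.hi l) {ε : ℝ} (hε : 0 < ε) (t : ℝ)
    (u : Fin m → ℝ) : ContinuousOn (C.drift t u) (restrictedSimplex m ε) :=
  continuousOn_finsetSum _ fun i _ =>
    ((continuousOn_const.mul (C.continuousOn_gateaux_psi hε i)).add
      (C.continuousOn_gateaux_penalty h hε i)).mul (by fun_prop)

theorem gateaux_penalty_eq_zero (h : ∀ l, C.lo l ≤ C.hi l) {ε : ℝ} (hε : 0 < ε)
    {p : Fin m → ℝ} (hp : p ∈ C.feasible ε) (i : Fin m) : gateaux C.penalty p i = 0 := by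
  rw [C.gateaux_penalty h (pos_of_mem hε hp.1)]
  have : ∀ l, C.outProb p l - C.proj l (C.outProb p l) = 0 := by
    intro l
    rw [C.proj_eq (h l), min_eq_right (hp.2 l).2, max_eq_right (hp.2 l).1, sub_self]
  simp [this]

theorem drift_eq (t : ℝ) (u v p : Fin m → ℝ) :
    C.drift t u p = t * ∑ i, gateaux C.psi p i * (p i - v i) +
      ∑ i, gateaux C.penalty p i * (p i - v i) + t * ∑ i, gateaux C.psi p i * (v i - u i) +
      ∑ i, gateaux C.penalty p i * (v i - u i) := by
  simp only [drift, Finset.mul_sum, ← Finset.sum_add_distrib]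
  exact Finset.sum_congr rfl fun i _ => by ring

theorem abs_sum_mul_sub_le (f u v : Fin m → ℝ) :
    |∑ i, f i * (v i - u i)| ≤ (∑ i, |f i|) * ‖u - v‖ := by
  rw [Finset.sum_mul]
  refine (Finset.abs_sum_le_sum_abs _ _).trans (Finset.sum_le_sum fun i _ => ?_)
  rw [abs_mul, abs_sub_comm]
  exact mul_le_mul_of_nonneg_left (norm_le_pi_norm (u - v) i) (abs_nonneg _)

/-- Limit points at which the drift is negligible relative to the penalty coefficient are
optimal. -/
theorem eq_of_tendsto_of_drift_le (h : ∀ l, C.lo l ≤ C.hi l) {ε : ℝ} (hε : 0 < ε)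
    {pStar : Fin m → ℝ} (hA1 : C.ConvexityCriterion ε pStar) {t d : ℕ → ℝ} {K : ℝ}
    {u x : ℕ → Fin m → ℝ} {y : Fin m → ℝ} (ht : ∀ k, 0 < t k) (ht0 : Tendsto t atTop (𝓝 0))
    (hd : Tendsto d atTop (𝓝 0)) (hx : ∀ k, x k ∈ restrictedSimplex m ε)
    (hxy : Tendsto x atTop (𝓝 y)) (hu : ∀ k, ‖u k - pStar‖ ≤ K * t k)
    (hdrift : ∀ k, C.drift (t k) (u k) (x k) ≤ t k * d k) : y = pStar := by
  have hy : y ∈ restrictedSimplex m ε :=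
    (isCompact_restrictedSimplex m ε).isClosed.mem_of_tendsto hxy (Eventually.of_forall hx)
  have hxy' : Tendsto x atTop (𝓝[restrictedSimplex m ε] y) :=
    tendsto_nhdsWithin_iff.2 ⟨hxy, Eventually.of_forall hx⟩
  have hψ : ∀ i, Tendsto (fun k => gateaux C.psi (x k) i) atTop (𝓝 (gateaux C.psi y i)) :=
    fun i => ((C.continuousOn_gateaux_psi hε i) y hy).tendsto.comp hxy'
  have hφ : ∀ i, Tendsto (fun k => gateaux C.penalty (x k) i) atTop
      (𝓝 (gateaux C.penalty y i)) :=
    fun i => ((C.continuousOn_gateaux_penalty h hε i) y hy).tendsto.comp hxy'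
  have hxi : ∀ i, Tendsto (fun k => x k i - pStar i) atTop (𝓝 (y i - pStar i)) := fun i =>
    ((continuous_apply i).tendsto y |>.comp hxy).sub_const _
  have ha : Tendsto (fun k => ∑ i, gateaux C.psi (x k) i * (x k i - pStar i)) atTop
      (𝓝 (∑ i, gateaux C.psi y i * (y i - pStar i))) :=
    tendsto_finsetSum _ fun i _ => (hψ i).mul (hxi i)
  have hb : Tendsto (fun k => ∑ i, gateaux C.penalty (x k) i * (x k i - pStar i)) atTop
      (𝓝 (∑ i, gateaux C.penalty y i * (y i - pStar i))) :=
    tendsto_finsetSum _ fun i _ => (hφ i).mul (hxi i)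
  have hψs : Tendsto (fun k => ∑ i, |gateaux C.psi (x k) i|) atTop
      (𝓝 (∑ i, |gateaux C.psi y i|)) := tendsto_finsetSum _ fun i _ => (hψ i).abs
  have hφs : Tendsto (fun k => ∑ i, |gateaux C.penalty (x k) i|) atTop
      (𝓝 (∑ i, |gateaux C.penalty y i|)) := tendsto_finsetSum _ fun i _ => (hφ i).abs
  -- Replacing `u k` by `pStar` in the drift costs `O(t k)`, by the rate assumption on the path; so
  -- the error keeps the factor `t k` needed for the later division.
  have hkey : ∀ k, t k * ∑ i, gateaux C.psi (x k) i * (x k i - pStar i) +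
      ∑ i, gateaux C.penalty (x k) i * (x k i - pStar i) ≤
      t k * (d k + (∑ i, |gateaux C.psi (x k) i|) * (K * t k) +
        (∑ i, |gateaux C.penalty (x k) i|) * K) := by
    intro k
    have h1 := hdrift k
    rw [C.drift_eq (t k) (u k) pStar] at h1
    have h2 := (abs_le.1 (abs_sum_mul_sub_le (gateaux C.psi (x k)) (u k) pStar)).1
    have h3 := (abs_le.1 (abs_sum_mul_sub_le (gateaux C.penalty (x k)) (u k) pStar)).1
    have h4 : (∑ i, |gateaux C.psi (x k) i|) * ‖u k - pStar‖ ≤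
        (∑ i, |gateaux C.psi (x k) i|) * (K * t k) :=
      mul_le_mul_of_nonneg_left (hu k) (Finset.sum_nonneg fun i _ => abs_nonneg _)
    have h5 : (∑ i, |gateaux C.penalty (x k) i|) * ‖u k - pStar‖ ≤
        (∑ i, |gateaux C.penalty (x k) i|) * (K * t k) :=
      mul_le_mul_of_nonneg_left (hu k) (Finset.sum_nonneg fun i _ => abs_nonneg _)
    have h6 := mul_le_mul_of_nonneg_left (neg_le.1 (h2.trans' (neg_le_neg h4))) (ht k).le
    linarith
  have hlim : Tendsto (fun k => d k + (∑ i, |gateaux C.psi (x k) i|) * (K * t k) +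
        (∑ i, |gateaux C.penalty (x k) i|) * K) atTop
      (𝓝 (∑ i, |gateaux C.penalty y i| * K)) := by
    have := (hd.add (hψs.mul (ht0.const_mul K))).add (hφs.mul_const K)
    simpa [Finset.sum_mul] using this
  have hbound : ∑ i, gateaux C.penalty y i * (y i - pStar i) ≤ 0 := by
    have h1 : Tendsto (fun k => t k * ∑ i, gateaux C.psi (x k) i * (x k i - pStar i) +
        ∑ i, gateaux C.penalty (x k) i * (x k i - pStar i)) atTop
        (𝓝 (∑ i, gateaux C.penalty y i * (y i - pStar i))) := by
      simpa using (ht0.mul ha).add hb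
    have h2 := ht0.mul hlim
    rw [zero_mul] at h2
    exact le_of_tendsto_of_tendsto' h1 h2 hkey
  have hyf : y ∈ C.feasible ε := by
    by_contra hyf
    exact absurd (hA1.infeasible_pos y hy hyf) (not_lt.2 hbound)
  -- The sign allows the penalty term to be dropped before dividing by `t k`, whatever its rate of
  -- decay.
  have hb0 : ∀ k, 0 ≤ ∑ i, gateaux C.penalty (x k) i * (x k i - pStar i) := by
    intro k
    by_cases hk : x k ∈ C.feasible ε
    · simp [C.gateaux_penalty_eq_zero h hε hk]
    · exact (hA1.infeasible_pos _ (hx k) hk).le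
  have ha0 : ∑ i, gateaux C.psi y i * (y i - pStar i) ≤ 0 := by
    have h1 : ∑ i, |gateaux C.penalty y i| * K = 0 := by
      simp [C.gateaux_penalty_eq_zero h hε hyf]
    rw [h1] at hlim
    refine le_of_tendsto_of_tendsto' ha hlim fun k => ?_
    refine le_of_mul_le_mul_left ?_ (ht k)
    linarith [hkey k, hb0 k]
  by_contra hne
  exact absurd (hA1.feasible_pos y hyf hne) (not_lt.2 ha0)

/-- The pathwise convergence argument: convergence of the divergences and summability of the
weighted drifts force the iterates to the optimum. -/
theorem tendsto_of_summable_drift (h : ∀ l, C.lo l ≤ C.hi l) {ε : ℝ} (hε : 0 < ε)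
    {pStar : Fin m → ℝ} (hA1 : C.ConvexityCriterion ε pStar) {t γ : ℕ → ℝ} {K : ℝ}
    {u x : ℕ → Fin m → ℝ} (ht : ∀ k, 0 < t k) (ht0 : Tendsto t atTop (𝓝 0))
    (hγ : ∀ k, 0 ≤ γ k) (hx : ∀ k, x k ∈ restrictedSimplex m ε)
    (huS : ∀ k, u k ∈ restrictedSimplex m ε) (hu : ∀ k, ‖u k - pStar‖ ≤ K * t k)
    (hsum : Summable fun k => γ k * C.drift (t k) (u k) (x k))
    (hdiv : ¬ Summable fun k => γ k * t k) {c : ℝ}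
    (hkl : Tendsto (fun k => kl (u k) (x k)) atTop (𝓝 c)) :
    Tendsto x atTop (𝓝 pStar) := by
  have hpS : pStar ∈ restrictedSimplex m ε := hA1.optimal.1.1
  have hfreq : ∀ N : ℕ, ∃ᶠ k in atTop,
      C.drift (t k) (u k) (x k) ≤ t k * (1 / ((N : ℝ) + 1)) := by
    -- Otherwise `γ k * t k ≤ (N + 1) * γ k * drift` eventually, and the divergent series would be
    -- dominated by a convergent one.
    intro N hN
    refine hdiv (Summable.of_norm_bounded_eventually_nat (hsum.mul_left ((N : ℝ) + 1)) ?_)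
    filter_upwards [hN] with k hk
    push Not at hk
    rw [Real.norm_of_nonneg (mul_nonneg (hγ k) (ht k).le)]
    have h1 : t k ≤ ((N : ℝ) + 1) * C.drift (t k) (u k) (x k) := by
      rw [mul_one_div, div_lt_iff₀ (by positivity)] at hk
      linarith
    calc γ k * t k ≤ γ k * (((N : ℝ) + 1) * C.drift (t k) (u k) (x k)) :=
          mul_le_mul_of_nonneg_left h1 (hγ k)
      _ = _ := by ring
  have hutend : Tendsto u atTop (𝓝 pStar) := by
    rw [tendsto_iff_norm_sub_tendsto_zero]
    refine squeeze_zero (fun k => norm_nonneg _) hu ?_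
    simpa using ht0.const_mul K
  have hlimit : ∀ (θ : ℕ → ℕ) (y : Fin m → ℝ), Tendsto θ atTop atTop →
      Tendsto (x ∘ θ) atTop (𝓝 y) → y ∈ restrictedSimplex m ε → kl pStar y = c := by
    intro θ y hθ hy hyS
    have h1 : Tendsto (fun k => (u (θ k), x (θ k))) atTop
        (𝓝[restrictedSimplex m ε ×ˢ restrictedSimplex m ε] (pStar, y)) :=
      tendsto_nhdsWithin_iff.2 ⟨(hutend.comp hθ).prodMk_nhds hy,
        Eventually.of_forall fun k => ⟨huS _, hx _⟩⟩
    have h2 := ((continuousOn_kl hε) (pStar, y) ⟨hpS, hyS⟩).tendsto.comp h1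
    exact tendsto_nhds_unique h2 (hkl.comp hθ)
  have hc : c = 0 := by
    obtain ⟨φ, hφ, hφ'⟩ := extraction_forall_of_frequently hfreq
    obtain ⟨y, hyS, ψ, hψ, hy⟩ := (isCompact_restrictedSimplex m ε).tendsto_subseq
      (x := x ∘ φ) fun k => hx _
    have hθ : Tendsto (φ ∘ ψ) atTop atTop := hφ.tendsto_atTop.comp hψ.tendsto_atTop
    have hyp : y = pStar := by
      refine C.eq_of_tendsto_of_drift_le h hε hA1 (t := t ∘ (φ ∘ ψ)) (u := u ∘ (φ ∘ ψ))
        (x := x ∘ (φ ∘ ψ)) (d := (fun N : ℕ => 1 / ((N : ℝ) + 1)) ∘ ψ) (K := K)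
        (fun k => ht _) (ht0.comp hθ) ?_ (fun k => hx _) hy (fun k => hu _)
        (fun k => hφ' (ψ k))
      exact tendsto_one_div_add_atTop_nhds_zero_nat.comp hψ.tendsto_atTop
    rw [← hlimit (φ ∘ ψ) y hθ hy hyS, hyp, kl_self (pos_of_mem hε hpS)]
  refine tendsto_of_subseq_tendsto fun θ hθ => ?_
  obtain ⟨y, hyS, ψ, hψ, hy⟩ := (isCompact_restrictedSimplex m ε).tendsto_subseq
    (x := x ∘ θ) fun k => hx _
  have h1 := hlimit (θ ∘ ψ) y (hθ.comp hψ.tendsto_atTop) hy hyS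
  rw [hc] at h1
  have h2 := eq_of_kl_eq_zero hpS.1.1 (pos_of_mem hε hyS) (hpS.1.2.trans hyS.1.2.symm) h1
  rw [h2] at hy
  exact ⟨ψ, hy⟩

end Problem

theorem measurable_mul_sum_abs_add {Ω ι : Type*} [Fintype ι] {m₀ : MeasurableSpace Ω}
    {f : ι → Ω → ℝ} (hf : ∀ i, Measurable (f i)) (a b c d : ℝ) :
    Measurable fun ω => a * (b * ∑ i, |f i ω| + c + d) := by
  have : Measurable fun ω => ∑ i, |f i ω| := Finset.measurable_fun_sum _ fun i _ => (hf i).abs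
  fun_prop

/-! ### Summability of the tracking errors -/

namespace IsRun

variable {𝒳 : Type*} [MeasurableSpace 𝒳] {m n T S : ℕ} {C : Problem 𝒳 m n T S} {ε : ℝ}
  {γ β lam : ℕ → ℝ} {M₁ M₂ M₃ : ℕ} {Ω : Type*} {mΩ : MeasurableSpace Ω} {μ : Measure Ω}
  {ℱ : Filtration ℕ mΩ} {X : ℕ → Ω → Fin M₁ → Fin T → 𝒳} {X' : ℕ → Ω → Fin M₂ → Fin T → 𝒳}
  {X'' : ℕ → Ω → Fin M₃ → Fin S → 𝒳} {p : ℕ → Ω → Fin m → ℝ} {s : ℕ → Ω → Fin n → ℝ}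

/-- The tracking errors of the slack variables are summable against the steps of `p`. -/
theorem summable_integral_slackError [MeasurableSingletonClass 𝒳] [IsProbabilityMeasure μ]
    (hrun : IsRun C ε γ β lam μ ℱ X X' X'' p s)
    (hε : 0 < ε) (hεm : ε < 1 / m) (hM₁ : 0 < M₁) {Λ : ℝ} (hΛ0 : 0 ≤ Λ)
    (hΛ : ∀ k, 1 ≤ k → |lam k| ≤ Λ) {a b α₁ α₂ : ℝ} (ha : 0 < a) (hb : 0 < b)
    (hα₂0 : 0 ≤ α₂) (hα₂ : 2 - 2 * α₁ < α₂ ∧ α₂ < 2 * α₁ - 1)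
    (hγ : ∀ k : ℕ, 1 ≤ k → γ k = a / (k : ℝ) ^ α₁)
    (hβ : ∀ k : ℕ, 1 ≤ k → β k = b / (k : ℝ) ^ α₂) (l : Fin n) :
    Summable fun k : ℕ => γ (k + 1) * ∫ ω, |slackError C p s l (k + 1) ω| ∂μ := by
  have hpos : ∀ k : ℕ, (0 : ℝ) < (k : ℝ) + 1 := fun k => by positivity
  have hγ' : ∀ k : ℕ, γ (k + 1) = a * ((k : ℝ) + 1) ^ (-α₁) := fun k => by
    rw [hγ _ (by omega), Real.rpow_neg (hpos k).le]; push_cast; rfl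
  have hβ' : ∀ k : ℕ, β (k + 1) = b * ((k : ℝ) + 1) ^ (-α₂) := fun k => by
    rw [hβ _ (by omega), Real.rpow_neg (hpos k).le]; push_cast; rfl
  obtain ⟨K, hK0, hK⟩ := hrun.exists_integral_sq_slackError_le hε hεm hM₁ (b := b) hΛ0 hΛ
    (fun k hk => by rw [hγ k hk]; positivity)
    (fun k hk => by
      have hk1 : (1 : ℝ) ≤ k := by exact_mod_cast hk
      rw [hβ k hk]
      exact ⟨by positivity, div_le_self hb.le (Real.one_le_rpow hk1 hα₂0)⟩) l
  obtain ⟨δ, hδ, hsum⟩ := exists_summable_weighted_of_recursion (b := 2 * b)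
    (C := K * (b ^ 2 + a ^ 2 / b)) (by positivity) (by positivity) hα₂.1 hα₂.2
    (x := fun k => ∫ ω, slackError C p s l (k + 1) ω ^ 2 ∂μ)
    (fun k => integral_nonneg fun ω => sq_nonneg _) (fun k => by
      refine (hK (k + 1) (by omega)).trans ?_
      have h1 : β (k + 1) ^ 2 = b ^ 2 * ((k : ℝ) + 1) ^ (-2 * α₂) := by
        rw [hβ', mul_pow, ← Real.rpow_natCast (_ ^ (-α₂)), ← Real.rpow_mul (hpos k).le]
        congr 2; push_cast; ring
      have h2 : γ (k + 1) ^ 2 / β (k + 1) = a ^ 2 / b * ((k : ℝ) + 1) ^ (-2 * α₁ + α₂) := by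
        have h3 : ((k : ℝ) + 1) ^ (-2 * α₁ + α₂) =
            (((k : ℝ) + 1) ^ (-α₁)) ^ 2 / ((k : ℝ) + 1) ^ (-α₂) := by
          rw [← Real.rpow_natCast, ← Real.rpow_mul (hpos k).le, ← Real.rpow_sub (hpos k)]
          congr 1; push_cast; ring
        rw [hγ', hβ', h3]
        field_simp
      rw [h1, h2, hβ']
      have h4 : 0 ≤ a ^ 2 / b * ((k : ℝ) + 1) ^ (-2 * α₂) := by positivity
      have h5 : 0 ≤ b ^ 2 * ((k : ℝ) + 1) ^ (-2 * α₁ + α₂) := by positivity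
      have h6 := mul_nonneg hK0 h4
      have h7 := mul_nonneg hK0 h5
      linarith)
  refine Summable.of_nonneg_of_le (fun k => mul_nonneg ?_ (integral_nonneg fun ω => abs_nonneg _))
    (fun k => ?_) ((summable_succ_rpow (r := -1 - δ) (by linarith)).add (hsum.mul_left (a ^ 2)))
  · rw [hγ']; have := hpos k; positivity
  · rw [← integral_const_mul]
    have hi := hrun.integrable_sq_slackError l (k := k + 1) (by omega)
    calc ∫ ω, γ (k + 1) * |slackError C p s l (k + 1) ω| ∂μ
        ≤ ∫ ω, (((k : ℝ) + 1) ^ (-1 - δ) + a ^ 2 * ((k : ℝ) + 1) ^ (1 + δ - 2 * α₁) *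
          slackError C p s l (k + 1) ω ^ 2) ∂μ := by
          refine integral_mono ((hrun.integrable_abs_slackError l (by omega)).const_mul _)
            ((integrable_const _).add (hi.const_mul _)) fun ω => ?_
          set e := |slackError C p s l (k + 1) ω| with he
          -- The factor `γ` is split as `a * r * q` so that `γ e ≤ r² + a² q² e²`, where `r²` is
          -- summable and `q²` is the weight for which the mean squares are summable.
          set r := ((k : ℝ) + 1) ^ ((-1 - δ) / 2) with hr
          set q := ((k : ℝ) + 1) ^ ((1 + δ - 2 * α₁) / 2) with hq
          have h1 : ((k : ℝ) + 1) ^ (-1 - δ) = r ^ 2 := by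
            rw [hr, ← Real.rpow_natCast, ← Real.rpow_mul (hpos k).le]
            congr 1; push_cast; ring
          have h2 : ((k : ℝ) + 1) ^ (1 + δ - 2 * α₁) = q ^ 2 := by
            rw [hq, ← Real.rpow_natCast, ← Real.rpow_mul (hpos k).le]
            congr 1; push_cast; ring
          have h3 : ((k : ℝ) + 1) ^ (-α₁) = r * q := by
            rw [hr, hq, ← Real.rpow_add (hpos k)]
            congr 1; ring
          have h4 : slackError C p s l (k + 1) ω ^ 2 = e ^ 2 := (sq_abs _).symm
          simp only [hγ', h1, h2, h3, h4]
          have hr0 : 0 ≤ r := (Real.rpow_pos_of_pos (hpos k) _).le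
          have hq0 : 0 ≤ q := (Real.rpow_pos_of_pos (hpos k) _).le
          have he0 : 0 ≤ e := abs_nonneg _
          have h5 : 0 ≤ r * (a * q * e) := by positivity
          nlinarith [sq_nonneg (r - a * q * e)]
      _ = ((k : ℝ) + 1) ^ (-1 - δ) + a ^ 2 * (((k : ℝ) + 1) ^ (1 + δ - 2 * α₁) *
          ∫ ω, slackError C p s l (k + 1) ω ^ 2 ∂μ) := by
          rw [integral_add (integrable_const _) (hi.const_mul _), integral_const_mul]
          simp [mul_assoc]

end IsRun

end MDSA

end

/-! ### Almost sure convergence of the iterates -/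

theorem theorem4
    {𝒳 : Type*} [MeasurableSpace 𝒳] [MeasurableSingletonClass 𝒳]
    {m n T S : ℕ} (C : MDSA.Problem 𝒳 m n T S)
    (ε : ℝ) (hε : 0 < ε) (hεm : ε < 1 / m)
    -- the three assumptions
    (pStar : Fin m → ℝ) (path : ℝ → Fin m → ℝ)
    (hA1 : C.ConvexityCriterion ε pStar)
    (hA2 : C.PenalizedPath ε path)
    (hA3 : (fun l => ‖path l - pStar‖) =O[𝓝[>] (0 : ℝ)] fun l => l)
    -- step sizes and penalty coefficients
    (a b c α₁ α₂ : ℝ) (ha : 0 < a) (hb : 0 < b) (hc : 0 < c)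
    (hα₁ : 3 / 4 < α₁ ∧ α₁ ≤ 1)
    (hα₂ : 2 - 2 * α₁ < α₂ ∧ α₂ < 2 * α₁ - 1)
    (γ β lam : ℕ → ℝ)
    (hγ : ∀ k : ℕ, 1 ≤ k → γ k = a / (k : ℝ) ^ α₁)
    (hβ : ∀ k : ℕ, 1 ≤ k → β k = b / (k : ℝ) ^ α₂)
    (hlam_lt : α₁ < 1 → ∃ α₃ : ℝ, 0 < α₃ ∧ α₃ ≤ 1 - α₁ ∧
      ∀ k : ℕ, 1 ≤ k → lam k = c / (k : ℝ) ^ α₃)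
    (hlam_one : α₁ = 1 → 0 < lam 1 ∧ ∀ k : ℕ, 2 ≤ k → lam k = c / Real.log k)
    -- the algorithm
    {M₁ M₂ M₃ : ℕ} (hM₁ : 0 < M₁) (hM₂ : 0 < M₂) (hM₃ : 0 < M₃)
    {Ω : Type*} {mΩ : MeasurableSpace Ω} (μ : Measure Ω) [IsProbabilityMeasure μ]
    (ℱ : Filtration ℕ mΩ)
    (X : ℕ → Ω → Fin M₁ → Fin T → 𝒳) (X' : ℕ → Ω → Fin M₂ → Fin T → 𝒳)
    (X'' : ℕ → Ω → Fin M₃ → Fin S → 𝒳)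
    (p : ℕ → Ω → Fin m → ℝ) (s : ℕ → Ω → Fin n → ℝ)
    (hrun : MDSA.IsRun C ε γ β lam μ ℱ X X' X'' p s) :
    ∀ᵐ ω ∂μ, Tendsto (fun k => p k ω) atTop (𝓝 pStar) := by
  have : Nonempty Ω := nonempty_of_isProbabilityMeasure μ
  have hlohi := hrun.lo_le_hi
  obtain ⟨l₀, hl₀, hpath, hBV⟩ := hA2
  obtain ⟨hlam0, hlam_anti, hlam_tend, hdiv⟩ :=
    MDSA.penalty_coefficient_properties ha hc hα₁.2 hγ hlam_lt hlam_one
  obtain ⟨Λ, hΛ⟩ := hlam_tend.norm.bddAbove_range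
  have hΛ' : ∀ k, |lam k| ≤ Λ := fun k => hΛ ⟨k, rfl⟩
  have hΛ0 : 0 ≤ Λ := (abs_nonneg _).trans (hΛ' 0)
  have hγ0 : ∀ k, 1 ≤ k → 0 ≤ γ k := fun k hk => by rw [hγ k hk]; positivity
  obtain ⟨K, hK0, hstep⟩ := hrun.exists_condExp_kl_le hε hεm hM₁ hM₂ hM₃ hΛ0
    (fun k _ => hΛ' k) hγ0
  obtain ⟨K', hK'⟩ := hA3.bound
  have hlam_within : Tendsto lam atTop (𝓝[>] 0) :=
    tendsto_nhdsWithin_iff.2 ⟨hlam_tend, (eventually_ge_atTop 2).mono hlam0⟩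
  obtain ⟨N, hN⟩ := eventually_atTop.1 ((hlam_within.eventually hK').and
    (hlam_tend.eventually (eventually_le_nhds hl₀)))
  -- From `k₀` on, the coefficients are positive, decreasing and at most `l₀`, and the rate bound on
  -- the path holds. Everything below is shifted by `k₀`, the filtration included.
  set k₀ := max N 2 with hk₀
  have hk₀2 : 2 ≤ k₀ := le_max_right _ _
  have hk₀N : N ≤ k₀ := le_max_left _ _
  set t : ℕ → ℝ := fun k => lam (k + k₀) with ht
  have ht0 : ∀ k, 0 < t k := fun k => hlam0 _ (by omega)
  have htmem : ∀ k, t k ∈ Set.Ioc 0 l₀ := fun k => ⟨ht0 k, (hN (k + k₀) (by omega)).2⟩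
  have htK : ∀ k, ‖path (t k) - pStar‖ ≤ K' * t k := fun k => by
    have h1 := (hN (k + k₀) (by omega)).1
    rwa [norm_norm, Real.norm_of_nonneg (ht0 k).le] at h1
  have ht_anti : Antitone t := antitone_nat_of_succ_le fun k => by
    have := hlam_anti (k + k₀) (by omega)
    rwa [show k + k₀ + 1 = k + 1 + k₀ by omega] at this
  have ht_tend : Tendsto t atTop (𝓝 0) := (tendsto_add_atTop_iff_nat k₀).2 hlam_tend
  set u : ℕ → Fin m → ℝ := fun k => path (t k) with hu
  have huS : ∀ k, u k ∈ MDSA.restrictedSimplex m ε := fun k => (hpath _ (htmem k)).1.1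
  have hps : ∀ k ω, p (k + k₀) ω ∈ MDSA.restrictedSimplex m ε := fun k ω =>
    hrun.mem_restrictedSimplex hε hεm (by omega) ω
  have hpm : ∀ k, Measurable[ℱ (k + k₀)] (p (k + k₀)) := fun k =>
    hrun.measurable_p _ (by omega)
  let 𝒢 : Filtration ℕ mΩ :=
    ⟨fun k => ℱ (k + k₀), fun i j hij => ℱ.mono (Nat.add_le_add_right hij k₀), fun k => ℱ.le _⟩
  set V : ℕ → Ω → ℝ := fun k ω => MDSA.kl (u k) (p (k + k₀) ω) with hV
  set A : ℕ → Ω → ℝ := fun k ω => γ (k + k₀) * C.drift (t k) (u k) (p (k + k₀) ω) with hA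
  set B : ℕ → Ω → ℝ := fun k ω => K * (γ (k + k₀) * ∑ l, |MDSA.IsRun.slackError C p s l (k + k₀) ω| +
    γ (k + k₀) ^ 2 + ‖u (k + 1) - u k‖) with hB
  have hVm : ∀ k, Measurable[ℱ (k + k₀)] (V k) := fun k =>
    (MDSA.measurable_kl (u k)).comp (hpm k)
  have hAm : ∀ k, Measurable[ℱ (k + k₀)] (A k) := fun k =>
    ((C.continuousOn_drift hlohi hε (t k) (u k)).measurable_comp_of_mem (hpm k)
      (hps k)).const_mul _
  have hBm : ∀ k, Measurable[ℱ (k + k₀)] (B k) := fun k =>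
    MDSA.measurable_mul_sum_abs_add (fun l => hrun.measurable_slackError l (by omega)) _ _ _ _
  have hVi : ∀ k, Integrable (V k) μ := fun k =>
    Integrable.of_bound ((hVm k).mono (ℱ.le _) le_rfl).aestronglyMeasurable (-Real.log ε)
      (ae_of_all _ fun ω => MDSA.abs_kl_le hε (huS k) (hps k ω))
  have hAi : ∀ k, Integrable (A k) μ := fun k => by
    obtain ⟨D, hD⟩ := (MDSA.isCompact_restrictedSimplex m ε).exists_bound_of_continuousOn
      (C.continuousOn_drift hlohi hε (t k) (u k))
    have hm := (C.continuousOn_drift hlohi hε (t k) (u k)).measurable_comp_of_mem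
      ((hpm k).mono (ℱ.le _) le_rfl) (hps k)
    exact (Integrable.of_bound hm.aestronglyMeasurable D
      (ae_of_all _ fun ω => hD _ (hps k ω))).const_mul _
  have hSi : ∀ k, Integrable
      (fun ω => ∑ l, |MDSA.IsRun.slackError C p s l (k + k₀) ω|) μ := fun k =>
    integrable_finsetSum _ fun l _ => hrun.integrable_abs_slackError l (by omega)
  have hBi : ∀ k, Integrable (B k) μ := fun k =>
    ((((hSi k).const_mul _).add (integrable_const _)).add (integrable_const _)).const_mul _
  have hdrift0 : ∀ k ω, 0 ≤ C.drift (t k) (u k) (p (k + k₀) ω) := fun k ω =>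
    (hpath _ (htmem k)).2 _ (hps k ω)
  have hBint : ∀ k, ∫ ω, B k ω ∂μ =
      K * (∑ l, γ (k + k₀) * ∫ ω, |MDSA.IsRun.slackError C p s l (k + k₀) ω| ∂μ +
        γ (k + k₀) ^ 2 + ‖u (k + 1) - u k‖) := by
    intro k
    have h1 : Integrable (fun ω => γ (k + k₀) *
      ∑ l, |MDSA.IsRun.slackError C p s l (k + k₀) ω|) μ := (hSi k).const_mul _
    have h2 : Integrable (fun ω => γ (k + k₀) *
      ∑ l, |MDSA.IsRun.slackError C p s l (k + k₀) ω| + γ (k + k₀) ^ 2) μ :=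
      h1.add (integrable_const _)
    simp only [hB]
    rw [integral_const_mul, integral_add h2 (integrable_const _),
      integral_add h1 (integrable_const _), integral_const_mul,
      integral_finsetSum _ fun l _ => hrun.integrable_abs_slackError l (by omega),
      Finset.mul_sum]
    simp
  have hBsum : Summable fun k => ∫ ω, B k ω ∂μ := by
    simp_rw [hBint]
    refine (((summable_sum fun l _ => ?_).add ?_).add ?_).mul_left K
    · have h1 := hrun.summable_integral_slackError hε hεm hM₁ hΛ0 (fun k _ => hΛ' k) ha hb
        -- Here `0 ≤ α₂` follows from `2 - 2 * α₁ < α₂` and `α₁ ≤ 1`.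
        (by linarith [hα₁.2, hα₂.1]) hα₂ hγ hβ l
      exact (summable_nat_add_iff
        (f := fun k => γ k * ∫ ω, |MDSA.IsRun.slackError C p s l k ω| ∂μ) k₀).2
        ((summable_nat_add_iff 1).1 h1)
    · refine (summable_nat_add_iff (f := fun k => γ k ^ 2) k₀).2
        ((summable_nat_add_iff 1).1 ?_)
      refine ((MDSA.summable_succ_rpow (r := -2 * α₁) (by linarith [hα₁.1])).mul_left
        (a ^ 2)).congr fun k => ?_
      have hk : (0 : ℝ) < (k : ℝ) + 1 := by positivity
      rw [hγ _ (by omega), div_pow, ← Real.rpow_natCast (_ ^ α₁), ← Real.rpow_mul (by positivity),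
        div_eq_mul_inv, ← Real.rpow_neg (by positivity)]
      push_cast
      congr 2
      ring
    · exact MDSA.summable_norm_sub_of_boundedVariationOn hBV ht_anti htmem
  have hRS := MDSA.ae_summable_and_tendsto_of_almost_supermartingale (μ := μ) (ℱ := 𝒢)
    (V := V) (A := A) (B := B) (fun k => (hVm k).stronglyMeasurable)
    (fun k => (hAm k).stronglyMeasurable) (fun k => (hBm k).stronglyMeasurable) hVi hAi hBi
    (fun k ω => MDSA.kl_nonneg (huS k).1.1 (MDSA.pos_of_mem hε (hps k ω))
      ((huS k).1.2.trans (hps k ω).1.2.symm))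
    (fun k ω => mul_nonneg (hγ0 _ (by omega)) (hdrift0 k ω))
    (fun k ω => mul_nonneg hK0 (add_nonneg (add_nonneg (mul_nonneg (hγ0 _ (by omega))
      (Finset.sum_nonneg fun l _ => abs_nonneg _)) (sq_nonneg _)) (norm_nonneg _)))
    (fun k => by
      have h1 := hstep (k + k₀) (by omega) (u k) (huS k) (u (k + 1)) (huS (k + 1))
      rw [show k + k₀ + 1 = k + 1 + k₀ by omega] at h1
      exact h1) hBsum
  filter_upwards [hRS] with ω ⟨hsum, c', hc'⟩
  rw [← tendsto_add_atTop_iff_nat k₀]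
  refine C.tendsto_of_summable_drift hlohi hε hA1 (t := t) (γ := fun k => γ (k + k₀)) (K := K')
    (u := u) (x := fun k => p (k + k₀) ω) ht0 ht_tend (fun k => hγ0 _ (by omega))
    (fun k => hps k ω) huS htK hsum ?_ hc'
  intro h1
  exact hdiv ((summable_nat_add_iff (f := fun k => γ k * lam k) k₀).1 h1)
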